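/- Let $n\ge 0$ and let $(M,\varphi,\xi,\eta,g)$ be an almost contact complex Riemannian (B-metric) manifold of dimension $2n+1$: $M$ is a smooth Hausdorff manifold, $\varphi$ is a smooth endomorphism field of $TM$, $\xi$ a smooth vector field, $\eta$ a smooth 1-form and $g$ a smooth pseudo-Riemannian metric of signature $(n+1,n)$ such that $$\varphi\xi=0,\quad \varphi^2=-\mathrm{Id}+\eta\otimes\xi,\quad \eta\circ\varphi=0,\quad \eta(\xi)=1,\quad g(\varphi x,\varphi y)=-g(x,y)+\eta(x)\eta(y).$$ Let $\nabla$ be the Levi-Civita connection of $g$, $H=\ker\eta$, $F(x,y,z)=g((\nabla_x\varphi)y,z)$, and $\widetilde g(x,y)=g(x,\varphi y)+\eta(x)\eta(y)$. The Nijenhuis tensor is $N=[\varphi,\varphi]+\mathrm d\eta\otimes\xi$ with $[\varphi,\varphi](x,y)=[\varphi x,\varphi y]+\varphi^2[x,y]-\varphi[\varphi x,y]-\varphi[x,\varphi y]$ and $\mathrm d\eta(x,y)=x\eta(y)-y\eta(x)-\eta([x,y])$. The associated Nijenhuis tensor is $\widehat N=\{\varphi,\varphi\}+(\mathcal L_\xi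 g)\otimes\xi$, where $\{x,y\}=\nabla_xy+\nabla_yx$ and $\{\varphi,\varphi\}(x,y)=\{\varphi x,\varphi y\}+\varphi^2\{x,y\}-\varphi\{\varphi x,y\}-\varphi\{x,\varphi y\}$. The complex cone of $M$ is $\mathcal C(M)=M\times\mathbb R^-$, where $r<0$ is the coordinate on $\mathbb R^-$, with the almost complex structure $\check J$ given by $\check JX=\varphi X$ for $X\in H$, $\check J\xi=r\frac{\mathrm d}{\mathrm dr}$, $\check J\frac{\mathrm d}{\mathrm dr}=-\frac1r\xi$, and the metric $$\check g\Bigl(\bigl(x,a\tfrac{\mathrm d}{\mathrm dr}\bigr),\bigl(y,b\tfrac{\mathrm d}{\mathrm dr}\bigr)\Bigr)=r^2\bigl(g(x,y)-\eta(x)\eta(y)\bigr)+\eta(x)\eta(y)-\frac{ab}{r^2},$$ that is, $\check g=r^2g|_H+\eta\otimes\eta-r^{-2}\mathrm dr^2$. A $2m$-dimensional manifold with a smooth almost complex structure $J$ and a smooth pseudo-Riemannian metric $h$ of signature $(m,m)$ is called holomorphic complex Riemannian (Kähler–Norden) if $h(Jx,Jy)=-h(x,y)$ and $J$ is parallel with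 respect to the Levi-Civita connection of $h$. Then the following conditions are equivalent. (a) $M$ is Sasaki-like, i.e. its complex cone $(\mathcal C(M),\check J,\check g)$ is a holomorphic complex Riemannian manifold. (a$'$) For all smooth horizontal vector fields $X,Y,Z$ (sections of $H$): $F(X,Y,Z)=F(\xi,Y,Z)=F(\xi,\xi,Z)=0$ and $F(X,Y,\xi)=-g(X,Y)$. (b) For all smooth vector fields $x,y$: $(\nabla_x\varphi)y=-g(x,y)\xi-\eta(y)x+2\eta(x)\eta(y)\xi$. (c) $N=0$ and $\widehat N=-4(\widetilde g-\eta\otimes\eta)\otimes\xi$. -/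

import Mathlib

open Bundle Manifold ContDiff

noncomputable section

namespace SasakiLike

section Tensors

variable {E : Type*} [NormedAddCommGroup E] [NormedSpace ℝ E]
  {H : Type*} [TopologicalSpace H] (I : ModelWithCorners ℝ E H)
  (M : Type*) [TopologicalSpace M] [ChartedSpace H M]

/-- (Not necessarily smooth) vector fields on `M`. -/
abbrev VField := ∀ p : M, TangentSpace I p

/-- (Not necessarily smooth) fields of endomorphisms of the tangent spaces. -/
abbrev EndField := ∀ p : M, TangentSpace I p →L[ℝ] TangentSpace I p

/-- (Not necessarily smooth) 1-forms on `M`. -/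
abbrev OneForm := ∀ p : M, TangentSpace I p →L[ℝ] ℝ

/-- (Not necessarily smooth) fields of bilinear forms on the tangent spaces. -/
abbrev BilinField := ∀ p : M, TangentSpace I p →L[ℝ] TangentSpace I p →L[ℝ] ℝ

variable {I M} [IsManifold I 1 M]

/-- `X ∈ 𝔛(M)`: the vector field `X` is smooth. -/
def SmoothVField (X : VField I M) : Prop :=
  ContMDiff I I.tangent ∞ (fun p ↦ (⟨p, X p⟩ : TangentBundle I M))

/-- The field of endomorphisms `A` is a smooth section of `End(TM)`. -/
def SmoothEndField (A : EndField I M) : Prop :=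
  ContMDiff I (I.prod 𝓘(ℝ, E →L[ℝ] E)) ∞
    (fun p ↦ TotalSpace.mk' (E →L[ℝ] E)
      (E := fun q : M ↦ TangentSpace I q →L[ℝ] TangentSpace I q) p (A p))

/-- The 1-form `α` is a smooth section of `T*M`. -/
def SmoothOneForm (α : OneForm I M) : Prop :=
  ContMDiff I (I.prod 𝓘(ℝ, E →L[ℝ] ℝ)) ∞
    (fun p ↦ TotalSpace.mk' (E →L[ℝ] ℝ)
      (E := fun q : M ↦ TangentSpace I q →L[ℝ] Trivial M ℝ q) p (α p))

/-- The field of bilinear forms `g` is a smooth (0,2)-tensor field. -/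
def SmoothBilinField (g : BilinField I M) : Prop :=
  ContMDiff I (I.prod 𝓘(ℝ, E →L[ℝ] E →L[ℝ] ℝ)) ∞
    (fun p ↦ TotalSpace.mk' (E →L[ℝ] E →L[ℝ] ℝ)
      (E := fun q : M ↦ TangentSpace I q →L[ℝ] TangentSpace I q →L[ℝ] Trivial M ℝ q) p (g p))

/-- The quadratic form `v ↦ g(v, v)` on the tangent space at `p`. -/
def quadraticFormAt (g : BilinField I M) (p : M) : QuadraticForm ℝ (TangentSpace I p) :=
  LinearMap.BilinMap.toQuadraticMap
    (LinearMap.mk₂ ℝ (fun v w : TangentSpace I p ↦ g p v w)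
      (fun _ _ _ ↦ by simp) (fun _ _ _ ↦ by simp) (fun _ _ _ ↦ by simp) (fun _ _ _ ↦ by simp))

/-- `g` is a smooth pseudo-Riemannian metric of signature `(k, l)`. -/
structure IsPseudoRiemannian (k l : ℕ) (g : BilinField I M) : Prop where
  smooth : SmoothBilinField g
  symm : ∀ p v w, g p v w = g p w v
  nondegenerate : ∀ p v, (∀ w, g p v w = 0) → v = 0
  sigPos_eq : ∀ p, sigPos (quadraticFormAt g p) = k
  sigNeg_eq : ∀ p, sigNeg (quadraticFormAt g p) = l

end Tensors

section LeviCivita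

variable {E : Type*} [NormedAddCommGroup E] [NormedSpace ℝ E]
  {H : Type*} [TopologicalSpace H] {I : ModelWithCorners ℝ E H}
  {M : Type*} [TopologicalSpace M] [ChartedSpace H M] [IsManifold I 1 M]

/-- The Lie bracket `[X, Y]` of vector fields. -/
abbrev bracket (X Y : VField I M) : VField I M := VectorField.mlieBracket I X Y

/-- The function `g(X, Y)`. -/
def pairing (g : BilinField I M) (X Y : VField I M) : M → ℝ := fun p ↦ g p (X p) (Y p)

/-- The derivative `X f` of the function `f` along the vector field `X`. -/
def deriveAlong (X : VField I M) (f : M → ℝ) : M → ℝ := fun p ↦ mvfderiv I f p (X p)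

/-- The right-hand side of the Koszul formula: the value of `2 g(∇_X Y, Z)`. -/
def koszul (g : BilinField I M) (X Y Z : VField I M) : M → ℝ := fun p ↦
  deriveAlong X (pairing g Y Z) p + deriveAlong Y (pairing g Z X) p
    - deriveAlong Z (pairing g X Y) p
    + pairing g (bracket X Y) Z p - pairing g (bracket Y Z) X p + pairing g (bracket Z X) Y p

open Classical in
/-- The covariant derivative `∇_X Y` with respect to the Levi-Civita connection of `g`: its value
at `p` is the vector `v` with `2 g(v, Z) = koszul(X, Y, Z)` at `p` for every `Z`. For a
pseudo-Riemannian metric `g` on a finite-dimensional manifold and vector fields `X`, `Y` which are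
differentiable at `p` this vector exists and is unique (`two_mul_leviCivita`,
`eq_leviCivita` below). -/
def leviCivita (g : BilinField I M) (X Y : VField I M) : VField I M := fun p ↦
  if h : ∃ v : TangentSpace I p, ∀ Z : VField I M,
      MDifferentiableAt I I.tangent (fun q ↦ (⟨q, Z q⟩ : TangentBundle I M)) p →
        2 * g p v (Z p) = koszul g X Y Z p
  then h.choose else 0

/-- The function `g(X, Y)` is differentiable at `p` if `X` and `Y` are. -/
lemma mdifferentiableAt_pairing {g : BilinField I M} (hg : SmoothBilinField g) {X Y : VField I M}
    {p : M} (hX : MDifferentiableAt I I.tangent (fun q ↦ (⟨q, X q⟩ : TangentBundle I M)) p)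
    (hY : MDifferentiableAt I I.tangent (fun q ↦ (⟨q, Y q⟩ : TangentBundle I M)) p) :
    MDifferentiableAt I 𝓘(ℝ, ℝ) (pairing g X Y) p := by
  have h1 := MDifferentiableAt.clm_bundle_apply
    ((hg.mdifferentiable (by simp)) p) hX
  have h2 := MDifferentiableAt.clm_bundle_apply (F₂ := ℝ) (E₂ := Trivial M ℝ) h1 hY
  rw [mdifferentiableAt_totalSpace] at h2
  exact h2.2

/-- The Koszul formula is tensorial in its last argument. -/
lemma tensorialAt_koszul [IsManifold I 2 M] [CompleteSpace E] {k l : ℕ} {g : BilinField I M}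
    (hg : IsPseudoRiemannian k l g) {X Y : VField I M} {p : M}
    (hX : MDifferentiableAt I I.tangent (fun q ↦ (⟨q, X q⟩ : TangentBundle I M)) p)
    (hY : MDifferentiableAt I I.tangent (fun q ↦ (⟨q, Y q⟩ : TangentBundle I M)) p) :
    TensorialAt I E (fun Z : VField I M ↦ koszul g X Y Z p) p where
  smul {f Z} hf hZ := by
    have e1 : pairing g Y (f • Z) = f * pairing g Y Z := by ext q; simp [pairing]
    have e2 : pairing g (f • Z) X = f * pairing g Z X := by ext q; simp [pairing]
    have d1 := mvfderiv_mul hf (mdifferentiableAt_pairing hg.smooth hY hZ)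
    have d2 := mvfderiv_mul hf (mdifferentiableAt_pairing hg.smooth hZ hX)
    have b1 := VectorField.mlieBracket_smul_right (V := Y) hf hZ
    have b2 := VectorField.mlieBracket_smul_left (W := X) hf hZ
    simp only [koszul, deriveAlong, e1, e2, d1, d2]
    simp [pairing, bracket, b1, b2, hg.symm p (Z p)]
    ring
  add {Z Z'} hZ hZ' := by
    have e1 : pairing g Y (Z + Z') = pairing g Y Z + pairing g Y Z' := by ext q; simp [pairing]
    have e2 : pairing g (Z + Z') X = pairing g Z X + pairing g Z' X := by ext q; simp [pairing]
    have d1 := mvfderiv_add (mdifferentiableAt_pairing hg.smooth hY hZ)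
      (mdifferentiableAt_pairing hg.smooth hY hZ')
    have d2 := mvfderiv_add (mdifferentiableAt_pairing hg.smooth hZ hX)
      (mdifferentiableAt_pairing hg.smooth hZ' hX)
    have b1 := VectorField.mlieBracket_add_right (V := Y) hZ hZ'
    have b2 := VectorField.mlieBracket_add_left (W := X) hZ hZ'
    simp only [koszul, deriveAlong, e1, e2, d1, d2]
    simp [pairing, bracket, b1, b2]
    ring

/-- Existence of `∇_X Y` at every point where `X` and `Y` are differentiable: it satisfies the
Koszul formula. -/
theorem two_mul_leviCivita [IsManifold I 2 M] [FiniteDimensional ℝ E] {k l : ℕ}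
    {g : BilinField I M} (hg : IsPseudoRiemannian k l g) {X Y : VField I M} {p : M}
    (hX : MDifferentiableAt I I.tangent (fun q ↦ (⟨q, X q⟩ : TangentBundle I M)) p)
    (hY : MDifferentiableAt I I.tangent (fun q ↦ (⟨q, Y q⟩ : TangentBundle I M)) p)
    (Z : VField I M)
    (hZ : MDifferentiableAt I I.tangent (fun q ↦ (⟨q, Z q⟩ : TangentBundle I M)) p) :
    2 * g p (leviCivita g X Y p) (Z p) = koszul g X Y Z p := by
  have : CompleteSpace E := FiniteDimensional.complete ℝ E
  have : FiniteDimensional ℝ (TangentSpace I p) := inferInstanceAs (FiniteDimensional ℝ E)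
  have hT := tensorialAt_koszul hg hX hY
  have hex : ∃ v : TangentSpace I p, ∀ Z : VField I M,
      MDifferentiableAt I I.tangent (fun q ↦ (⟨q, Z q⟩ : TangentBundle I M)) p →
        2 * g p v (Z p) = koszul g X Y Z p := by
    let B : LinearMap.BilinForm ℝ (TangentSpace I p) :=
      LinearMap.mk₂ ℝ (fun v w : TangentSpace I p ↦ g p v w)
        (fun _ _ _ ↦ by simp) (fun _ _ _ ↦ by simp) (fun _ _ _ ↦ by simp) (fun _ _ _ ↦ by simp)
    have hinj : Function.Injective B := by
      rw [← LinearMap.ker_eq_bot, LinearMap.ker_eq_bot']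
      intro v hv
      exact hg.nondegenerate p v (fun w ↦ congrArg (fun L ↦ L w) hv)
    have hsurj : Function.Surjective B :=
      (LinearMap.injective_iff_surjective_of_finrank_eq_finrank
        (Subspace.dual_finrank_eq (K := ℝ) (V := TangentSpace I p)).symm).1 hinj
    obtain ⟨v, hv⟩ := hsurj ((1 / 2 : ℝ) • (TensorialAt.mkHom _ p hT).toLinearMap)
    refine ⟨v, fun Z hZ ↦ ?_⟩
    have h1 : g p v (Z p) = (1 / 2 : ℝ) * TensorialAt.mkHom _ p hT (Z p) :=
      congrArg (fun L ↦ L (Z p)) hv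
    rw [h1, TensorialAt.mkHom_apply hT hZ]
    ring
  rw [leviCivita, dif_pos hex]
  exact hex.choose_spec Z hZ

/-- Uniqueness of `∇_X Y`. -/
theorem eq_leviCivita [IsManifold I 2 M] [FiniteDimensional ℝ E] {k l : ℕ}
    {g : BilinField I M} (hg : IsPseudoRiemannian k l g) {X Y : VField I M} {p : M}
    (hX : MDifferentiableAt I I.tangent (fun q ↦ (⟨q, X q⟩ : TangentBundle I M)) p)
    (hY : MDifferentiableAt I I.tangent (fun q ↦ (⟨q, Y q⟩ : TangentBundle I M)) p)
    (v : TangentSpace I p)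
    (hv : ∀ Z : VField I M,
      MDifferentiableAt I I.tangent (fun q ↦ (⟨q, Z q⟩ : TangentBundle I M)) p →
        2 * g p v (Z p) = koszul g X Y Z p) :
    v = leviCivita g X Y p := by
  rw [← sub_eq_zero]
  refine hg.nondegenerate p _ (fun w ↦ ?_)
  have hZ := FiberBundle.mdifferentiableAt_extend I E w
  have h1 := hv _ hZ
  have h2 := two_mul_leviCivita hg hX hY _ hZ
  simp only [FiberBundle.extend_apply_self] at h1 h2
  simp only [map_sub, _root_.sub_apply]
  linarith

/-- `(∇_X A) Y = ∇_X (A Y) - A (∇_X Y)` for a field of endomorphisms `A`, where `∇` is the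
Levi-Civita connection of `g`. -/
def covDerivEnd (g : BilinField I M) (A : EndField I M) (X Y : VField I M) : VField I M :=
  fun p ↦ leviCivita g X (fun q ↦ A q (Y q)) p - A p (leviCivita g X Y p)

end LeviCivita

section AlmostContact

variable {E : Type*} [NormedAddCommGroup E] [NormedSpace ℝ E]
  {H : Type*} [TopologicalSpace H] {I : ModelWithCorners ℝ E H}
  {M : Type*} [TopologicalSpace M] [ChartedSpace H M] [IsManifold I 1 M]

/-- `(M, φ, ξ, η, g)` is an almost contact complex Riemannian manifold (almost contact B-metric
manifold); here `dim M = 2n + 1`. -/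
structure IsAlmostContactComplexRiemannian (n : ℕ)
    (φ : EndField I M) (ξ : VField I M) (η : OneForm I M) (g : BilinField I M) : Prop where
  smooth_φ : SmoothEndField φ
  smooth_ξ : SmoothVField ξ
  smooth_η : SmoothOneForm η
  φ_ξ : ∀ p, φ p (ξ p) = 0
  φ_φ : ∀ p v, φ p (φ p v) = -v + η p v • ξ p
  η_φ : ∀ p v, η p (φ p v) = 0
  η_ξ : ∀ p, η p (ξ p) = 1
  metric : IsPseudoRiemannian (n + 1) n g
  compatible : ∀ p v w, g p (φ p v) (φ p w) = -g p v w + η p v * η p w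

/-- The associated metric `g̃(x, y) = g(x, φ y) + η(x) η(y)`. -/
def associatedMetric (φ : EndField I M) (η : OneForm I M) (g : BilinField I M)
    (p : M) (v w : TangentSpace I p) : ℝ :=
  g p v (φ p w) + η p v * η p w

/-- The exterior derivative `dη(X, Y) = X η(Y) - Y η(X) - η([X, Y])`. -/
def dEta (η : OneForm I M) (X Y : VField I M) : M → ℝ := fun p ↦
  deriveAlong X (fun q ↦ η q (Y q)) p - deriveAlong Y (fun q ↦ η q (X q)) p
    - η p (bracket X Y p)

/-- The Nijenhuis tensor `N = [φ, φ] + dη ⊗ ξ`. -/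
def nijenhuis (φ : EndField I M) (ξ : VField I M) (η : OneForm I M) (X Y : VField I M) :
    VField I M := fun p ↦
  bracket (fun q ↦ φ q (X q)) (fun q ↦ φ q (Y q)) p + φ p (φ p (bracket X Y p))
    - φ p (bracket (fun q ↦ φ q (X q)) Y p) - φ p (bracket X (fun q ↦ φ q (Y q)) p)
    + dEta η X Y p • ξ p

/-- The symmetric bracket `{X, Y} = ∇_X Y + ∇_Y X`. -/
def symmBracket (g : BilinField I M) (X Y : VField I M) : VField I M := fun p ↦
  leviCivita g X Y p + leviCivita g Y X p

/-- The Lie derivative `(L_ξ g)(X, Y) = ξ g(X, Y) - g([ξ, X], Y) - g(X, [ξ, Y])`. -/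
def lieDerivMetric (ξ : VField I M) (g : BilinField I M) (X Y : VField I M) : M → ℝ := fun p ↦
  deriveAlong ξ (pairing g X Y) p - pairing g (bracket ξ X) Y p - pairing g X (bracket ξ Y) p

/-- The associated Nijenhuis tensor `N̂ = {φ, φ} + (L_ξ g) ⊗ ξ`. -/
def assocNijenhuis (φ : EndField I M) (ξ : VField I M) (g : BilinField I M) (X Y : VField I M) :
    VField I M := fun p ↦
  symmBracket g (fun q ↦ φ q (X q)) (fun q ↦ φ q (Y q)) p + φ p (φ p (symmBracket g X Y p))
    - φ p (symmBracket g (fun q ↦ φ q (X q)) Y p) - φ p (symmBracket g X (fun q ↦ φ q (Y q)) p)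
    + lieDerivMetric ξ g X Y p • ξ p

/-- The structure tensor `F(X, Y, Z) = g((∇_X φ) Y, Z)`. -/
def structureTensor (φ : EndField I M) (g : BilinField I M) (X Y Z : VField I M) : M → ℝ :=
  pairing g (covDerivEnd g φ X Y) Z

/-- `X` is a smooth horizontal vector field, `X ∈ H = ker η`. -/
def SmoothHorizontal (η : OneForm I M) (X : VField I M) : Prop :=
  SmoothVField X ∧ ∀ p, η p (X p) = 0

/-- The Sasaki-like condition in terms of the structure tensor: for horizontal `X`, `Y`, `Z`,
`F(X, Y, Z) = F(ξ, Y, Z) = F(ξ, ξ, Z) = 0` and `F(X, Y, ξ) = -g(X, Y)`. -/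
def SasakiLikeTensorConditions (φ : EndField I M) (ξ : VField I M) (η : OneForm I M)
    (g : BilinField I M) : Prop :=
  ∀ X Y Z : VField I M, SmoothHorizontal η X → SmoothHorizontal η Y → SmoothHorizontal η Z →
    ∀ p, structureTensor φ g X Y Z p = 0 ∧ structureTensor φ g ξ Y Z p = 0 ∧
      structureTensor φ g ξ ξ Z p = 0 ∧ structureTensor φ g X Y ξ p = -pairing g X Y p

end AlmostContact

section Holomorphic

variable {E : Type*} [NormedAddCommGroup E] [NormedSpace ℝ E]
  {H : Type*} [TopologicalSpace H] {I : ModelWithCorners ℝ E H}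
  {M : Type*} [TopologicalSpace M] [ChartedSpace H M] [IsManifold I 1 M]

/-- `(M, J, g)` is a holomorphic complex Riemannian manifold (Kähler–Norden manifold) of real
dimension `2m`: `J` is an almost complex structure, `g` is a pseudo-Riemannian metric of neutral
signature `(m, m)`, `J` is an anti-isometry of `g`, and `J` is parallel with respect to the
Levi-Civita connection of `g`. -/
structure IsHolomorphicComplexRiemannian (m : ℕ)
    (J : EndField I M) (g : BilinField I M) : Prop where
  smooth_J : SmoothEndField J
  J_J : ∀ p v, J p (J p v) = -v
  metric : IsPseudoRiemannian m m g
  norden : ∀ p v w, g p (J p v) (J p w) = -g p v w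
  parallel : ∀ X Y : VField I M, SmoothVField X → SmoothVField Y →
    ∀ p, covDerivEnd g J X Y p = 0

end Holomorphic

section Cone

/-- The open half-line `ℝ⁻` of negative reals, as an open submanifold of `ℝ`. -/
def negReals : TopologicalSpace.Opens ℝ := ⟨Set.Iio 0, isOpen_Iio⟩

/-- The underlying manifold `M × ℝ⁻` of the cone over `M`. -/
abbrev Cone (M : Type*) := M × negReals

variable {E : Type*} [NormedAddCommGroup E] [NormedSpace ℝ E]
  {H : Type*} [TopologicalSpace H] {I : ModelWithCorners ℝ E H}
  {M : Type*} [TopologicalSpace M] [ChartedSpace H M]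

/-- The `M`-component `x` of a tangent vector `(x, a d/dr)` of the cone. -/
def horiz (p : Cone M) : TangentSpace (I.prod 𝓘(ℝ, ℝ)) p →L[ℝ] TangentSpace I p.1 :=
  ContinuousLinearMap.fst ℝ (TangentSpace I p.1) (TangentSpace 𝓘(ℝ, ℝ) p.2)

/-- The coefficient `a` of `d/dr` in a tangent vector `(x, a d/dr)` of the cone. -/
def radial (p : Cone M) : TangentSpace (I.prod 𝓘(ℝ, ℝ)) p →L[ℝ] ℝ :=
  ContinuousLinearMap.snd ℝ (TangentSpace I p.1) (TangentSpace 𝓘(ℝ, ℝ) p.2)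

/-- The almost complex structure on the cone with `J X = φ X` for `X` horizontal,
`J ξ = r d/dr` and `J d/dr = -(1/r) ξ`. In one formula,
`J (x, a d/dr) = (φ x - (a/r) ξ, r η(x) d/dr)`. -/
def coneJ (φ : EndField I M) (ξ : VField I M) (η : OneForm I M) :
    EndField (I.prod 𝓘(ℝ, ℝ)) (Cone M) := fun p ↦
  ContinuousLinearMap.prod
    (φ p.1 ∘L horiz p - ((p.2 : ℝ)⁻¹ • radial p).smulRight (ξ p.1))
    ((p.2 : ℝ) • (η p.1 ∘L horiz p))

/-- The complex Riemannian metric of the cone, `r² g|_H + η ⊗ η - r⁻² dr²`, where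
`g|_H = g - η ⊗ η` is the horizontal part of `g`. -/
def coneMetric (η : OneForm I M) (g : BilinField I M) :
    BilinField (I.prod 𝓘(ℝ, ℝ)) (Cone M) := fun p ↦
  (p.2 : ℝ) ^ 2 • (ContinuousLinearMap.precomp ℝ (horiz p) ∘L (g p.1 ∘L horiz p)
      - (η p.1 ∘L horiz p).smulRight (η p.1 ∘L horiz p))
    + (η p.1 ∘L horiz p).smulRight (η p.1 ∘L horiz p)
    - ((p.2 : ℝ) ^ 2)⁻¹ • (radial p).smulRight (radial p)

end Cone

end SasakiLike

end

noncomputable section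

namespace SasakiLike

section Connection

variable {E : Type*} [NormedAddCommGroup E] [NormedSpace ℝ E]
  {H : Type*} [TopologicalSpace H] {I : ModelWithCorners ℝ E H}
  {M : Type*} [TopologicalSpace M] [ChartedSpace H M] [IsManifold I 1 M]

/-- The vector field `X` is differentiable at `p`. -/
abbrev DiffAt (X : VField I M) (p : M) : Prop :=
  MDifferentiableAt I I.tangent (fun q ↦ (⟨q, X q⟩ : TangentBundle I M)) p

lemma SmoothVField.diffAt {X : VField I M} (hX : SmoothVField X) (p : M) : DiffAt X p :=
  hX.mdifferentiable (by simp) p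

lemma DiffAt.add {X Y : VField I M} {p : M} (hX : DiffAt X p) (hY : DiffAt Y p) :
    DiffAt (X + Y) p :=
  mdifferentiableAt_add_section hX hY

lemma DiffAt.smul {X : VField I M} {f : M → ℝ} {p : M} (hf : MDifferentiableAt I 𝓘(ℝ, ℝ) f p)
    (hX : DiffAt X p) : DiffAt (f • X) p :=
  hf.smul_section hX

lemma SmoothEndField.diffAt {A : EndField I M} (hA : SmoothEndField A) {X : VField I M} {p : M}
    (hX : DiffAt X p) : DiffAt (fun q ↦ A q (X q)) p :=
  MDifferentiableAt.clm_bundle_apply (hA.mdifferentiable (by simp) p) hX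

lemma SmoothEndField.smooth {A : EndField I M} (hA : SmoothEndField A) {X : VField I M}
    (hX : SmoothVField X) : SmoothVField (fun q ↦ A q (X q)) :=
  ContMDiff.clm_bundle_apply hA hX

lemma SmoothOneForm.mdifferentiableAt {α : OneForm I M} (hα : SmoothOneForm α) {X : VField I M}
    {p : M} (hX : DiffAt X p) : MDifferentiableAt I 𝓘(ℝ, ℝ) (fun q ↦ α q (X q)) p := by
  have h := MDifferentiableAt.clm_bundle_apply (F₂ := ℝ) (E₂ := Trivial M ℝ)
    (hα.mdifferentiable (by simp) p) hX
  rw [mdifferentiableAt_totalSpace] at h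
  exact h.2

variable {k l : ℕ} {g : BilinField I M} {p : M}

/-- A tangent vector is determined by its products with differentiable vector fields. -/
lemma IsPseudoRiemannian.eq_of_forall (hg : IsPseudoRiemannian k l g) {v w : TangentSpace I p}
    (h : ∀ Z : VField I M, DiffAt Z p → g p v (Z p) = g p w (Z p)) : v = w := by
  rw [← sub_eq_zero]
  refine hg.nondegenerate p _ (fun u ↦ ?_)
  have := h _ (FiberBundle.mdifferentiableAt_extend I E u)
  simp only [FiberBundle.extend_apply_self] at this
  simp [this]

variable [IsManifold I 2 M] [FiniteDimensional ℝ E]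

lemma leviCivita_add_left (hg : IsPseudoRiemannian k l g) {X X' Y : VField I M}
    (hX : DiffAt X p) (hX' : DiffAt X' p) (hY : DiffAt Y p) :
    leviCivita g (X + X') Y p = leviCivita g X Y p + leviCivita g X' Y p := by
  have : CompleteSpace E := FiniteDimensional.complete ℝ E
  refine hg.eq_of_forall fun Z hZ ↦ ?_
  have h0 := two_mul_leviCivita hg (hX.add hX') hY Z hZ
  have h1 := two_mul_leviCivita hg hX hY Z hZ
  have h2 := two_mul_leviCivita hg hX' hY Z hZ
  have e1 : pairing g Z (X + X') = pairing g Z X + pairing g Z X' := by ext q; simp [pairing]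
  have e2 : pairing g (X + X') Y = pairing g X Y + pairing g X' Y := by ext q; simp [pairing]
  have d1 := mvfderiv_add (mdifferentiableAt_pairing hg.smooth hZ hX)
    (mdifferentiableAt_pairing hg.smooth hZ hX')
  have d2 := mvfderiv_add (mdifferentiableAt_pairing hg.smooth hX hY)
    (mdifferentiableAt_pairing hg.smooth hX' hY)
  have b1 := VectorField.mlieBracket_add_right (V := Z) hX hX'
  have b2 := VectorField.mlieBracket_add_left (W := Y) hX hX'
  simp only [koszul, deriveAlong, e1, e2, d1, d2] at h0 h1 h2
  simp only [pairing, bracket, b1, b2, Pi.add_apply, map_add, _root_.add_apply] at h0 h1 h2 ⊢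
  linarith

lemma leviCivita_smul_left (hg : IsPseudoRiemannian k l g) {f : M → ℝ} {X Y : VField I M}
    (hf : MDifferentiableAt I 𝓘(ℝ, ℝ) f p) (hX : DiffAt X p) (hY : DiffAt Y p) :
    leviCivita g (f • X) Y p = f p • leviCivita g X Y p := by
  have : CompleteSpace E := FiniteDimensional.complete ℝ E
  refine hg.eq_of_forall fun Z hZ ↦ ?_
  have h0 := two_mul_leviCivita hg (hX.smul hf) hY Z hZ
  have h1 := two_mul_leviCivita hg hX hY Z hZ
  have e1 : pairing g Z (f • X) = f * pairing g Z X := by ext q; simp [pairing]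
  have e2 : pairing g (f • X) Y = f * pairing g X Y := by ext q; simp [pairing]
  have d1 := mvfderiv_mul hf (mdifferentiableAt_pairing hg.smooth hZ hX)
  have d2 := mvfderiv_mul hf (mdifferentiableAt_pairing hg.smooth hX hY)
  have b1 := VectorField.mlieBracket_smul_right (V := Z) hf hX
  have b2 := VectorField.mlieBracket_smul_left (W := Y) hf hX
  simp only [koszul, deriveAlong, e1, e2, d1, d2] at h0 h1
  simp [pairing, bracket, b1, b2] at h0 h1 ⊢
  rw [hg.symm p (Z p) (X p)] at h0
  linear_combination h0 / 2 - f p * h1 / 2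

lemma leviCivita_add_right (hg : IsPseudoRiemannian k l g) {X Y Y' : VField I M}
    (hX : DiffAt X p) (hY : DiffAt Y p) (hY' : DiffAt Y' p) :
    leviCivita g X (Y + Y') p = leviCivita g X Y p + leviCivita g X Y' p := by
  have : CompleteSpace E := FiniteDimensional.complete ℝ E
  refine hg.eq_of_forall fun Z hZ ↦ ?_
  have h0 := two_mul_leviCivita hg hX (hY.add hY') Z hZ
  have h1 := two_mul_leviCivita hg hX hY Z hZ
  have h2 := two_mul_leviCivita hg hX hY' Z hZ
  have e1 : pairing g X (Y + Y') = pairing g X Y + pairing g X Y' := by ext q; simp [pairing]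
  have e2 : pairing g (Y + Y') Z = pairing g Y Z + pairing g Y' Z := by ext q; simp [pairing]
  have d1 := mvfderiv_add (mdifferentiableAt_pairing hg.smooth hX hY)
    (mdifferentiableAt_pairing hg.smooth hX hY')
  have d2 := mvfderiv_add (mdifferentiableAt_pairing hg.smooth hY hZ)
    (mdifferentiableAt_pairing hg.smooth hY' hZ)
  have b1 := VectorField.mlieBracket_add_right (V := X) hY hY'
  have b2 := VectorField.mlieBracket_add_left (W := Z) hY hY'
  simp only [koszul, deriveAlong, e1, e2, d1, d2] at h0 h1 h2
  simp only [pairing, bracket, b1, b2, Pi.add_apply, map_add, _root_.add_apply] at h0 h1 h2 ⊢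
  linarith

lemma leviCivita_smul_right (hg : IsPseudoRiemannian k l g) {f : M → ℝ} {X Y : VField I M}
    (hf : MDifferentiableAt I 𝓘(ℝ, ℝ) f p) (hX : DiffAt X p) (hY : DiffAt Y p) :
    leviCivita g X (f • Y) p = deriveAlong X f p • Y p + f p • leviCivita g X Y p := by
  have : CompleteSpace E := FiniteDimensional.complete ℝ E
  refine hg.eq_of_forall fun Z hZ ↦ ?_
  have h0 := two_mul_leviCivita hg hX (hY.smul hf) Z hZ
  have h1 := two_mul_leviCivita hg hX hY Z hZ
  have e1 : pairing g X (f • Y) = f * pairing g X Y := by ext q; simp [pairing]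
  have e2 : pairing g (f • Y) Z = f * pairing g Y Z := by ext q; simp [pairing]
  have d1 := mvfderiv_mul hf (mdifferentiableAt_pairing hg.smooth hX hY)
  have d2 := mvfderiv_mul hf (mdifferentiableAt_pairing hg.smooth hY hZ)
  have b1 := VectorField.mlieBracket_smul_right (V := X) hf hY
  have b2 := VectorField.mlieBracket_smul_left (W := Z) hf hY
  simp only [koszul, deriveAlong, e1, e2, d1, d2] at h0 h1 ⊢
  simp [pairing, bracket, b1, b2] at h0 h1 ⊢
  rw [hg.symm p (Y p) (X p)] at h0
  linear_combination h0 / 2 - f p * h1 / 2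

/-- The Levi-Civita connection is torsion-free. -/
lemma leviCivita_sub_swap (hg : IsPseudoRiemannian k l g) {X Y : VField I M}
    (hX : DiffAt X p) (hY : DiffAt Y p) :
    leviCivita g X Y p - leviCivita g Y X p = bracket X Y p := by
  refine hg.eq_of_forall fun Z hZ ↦ ?_
  have h0 := two_mul_leviCivita hg hX hY Z hZ
  have h1 := two_mul_leviCivita hg hY hX Z hZ
  have e (U V : VField I M) : pairing g U V = pairing g V U := by
    ext q; exact hg.symm q _ _
  have b (U V : VField I M) : bracket U V p = - bracket V U p :=
    VectorField.mlieBracket_swap_apply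
  simp only [koszul, deriveAlong] at h0 h1
  rw [e X Z, e Z Y, e Y X] at h1
  simp only [pairing, map_sub, _root_.sub_apply] at h0 h1 ⊢
  rw [b Z X, b Y Z] at h0
  rw [b Y X] at h1
  simp only [map_neg, _root_.neg_apply] at h0 h1
  linarith

/-- The Levi-Civita connection is metric. -/
lemma deriveAlong_pairing (hg : IsPseudoRiemannian k l g) {X Y Z : VField I M}
    (hX : DiffAt X p) (hY : DiffAt Y p) (hZ : DiffAt Z p) :
    deriveAlong X (pairing g Y Z) p
      = g p (leviCivita g X Y p) (Z p) + g p (Y p) (leviCivita g X Z p) := by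
  have h0 := two_mul_leviCivita hg hX hY Z hZ
  have h1 := two_mul_leviCivita hg hX hZ Y hY
  have e (U V : VField I M) : pairing g U V = pairing g V U := by
    ext q; exact hg.symm q _ _
  have b (U V : VField I M) : bracket U V p = - bracket V U p :=
    VectorField.mlieBracket_swap_apply
  rw [hg.symm p (Y p)]
  simp only [koszul] at h0 h1
  rw [e Z Y, e X Z] at h1
  rw [e X Y] at h0
  simp only [pairing] at h0 h1 ⊢
  rw [b Z X] at h0
  rw [b Z Y, b Y X] at h1
  simp only [map_neg, _root_.neg_apply] at h0 h1
  linarith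

lemma tensorialAt_covDerivEnd_left (hg : IsPseudoRiemannian k l g) {A : EndField I M}
    (hA : SmoothEndField A) {Y : VField I M} (hY : DiffAt Y p) :
    TensorialAt I E (fun X : VField I M ↦ covDerivEnd g A X Y p) p where
  smul hf hX := by
    simp only [covDerivEnd]
    rw [leviCivita_smul_left hg hf hX (hA.diffAt hY), leviCivita_smul_left hg hf hX hY]
    simp [smul_sub]
  add hX hX' := by
    simp only [covDerivEnd]
    rw [leviCivita_add_left hg hX hX' (hA.diffAt hY), leviCivita_add_left hg hX hX' hY]
    simp only [map_add]
    abel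

lemma tensorialAt_covDerivEnd_right (hg : IsPseudoRiemannian k l g) {A : EndField I M}
    (hA : SmoothEndField A) {X : VField I M} (hX : DiffAt X p) :
    TensorialAt I E (fun Y : VField I M ↦ covDerivEnd g A X Y p) p where
  smul {f Y} hf hY := by
    have e : (fun q ↦ A q ((f • Y) q)) = f • fun q ↦ A q (Y q) := by ext q; simp
    simp only [covDerivEnd]
    rw [e, leviCivita_smul_right hg hf hX (hA.diffAt hY), leviCivita_smul_right hg hf hX hY]
    simp only [map_add, map_smul, smul_sub]
    abel
  add {Y Y'} hY hY' := by
    have e : (fun q ↦ A q ((Y + Y') q)) = (fun q ↦ A q (Y q)) + fun q ↦ A q (Y' q) := by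
      ext q; simp
    simp only [covDerivEnd]
    rw [e, leviCivita_add_right hg hX (hA.diffAt hY) (hA.diffAt hY'),
      leviCivita_add_right hg hX hY hY']
    simp only [map_add]
    abel

/-- The value of `∇A` at `p`, as a bilinear map. -/
def covDerivEndAt (hg : IsPseudoRiemannian k l g) {A : EndField I M} (hA : SmoothEndField A)
    (p : M) : TangentSpace I p →L[ℝ] TangentSpace I p →L[ℝ] TangentSpace I p :=
  TensorialAt.mkHom₂ (I := I) (F := E) (F' := E)
    (fun X Y : VField I M ↦ covDerivEnd g A X Y p) p
    (fun _ hY ↦ tensorialAt_covDerivEnd_left hg hA hY)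
    (fun _ hX ↦ tensorialAt_covDerivEnd_right hg hA hX)

lemma covDerivEndAt_apply (hg : IsPseudoRiemannian k l g) {A : EndField I M}
    (hA : SmoothEndField A) {X Y : VField I M} (hX : DiffAt X p) (hY : DiffAt Y p) :
    covDerivEndAt hg hA p (X p) (Y p) = covDerivEnd g A X Y p :=
  TensorialAt.mkHom₂_apply _ _ hX hY

end Connection

section Extension

variable {E : Type*} [NormedAddCommGroup E] [NormedSpace ℝ E] [FiniteDimensional ℝ E]
  {H : Type*} [TopologicalSpace H] {I : ModelWithCorners ℝ E H}
  {M : Type*} [TopologicalSpace M] [ChartedSpace H M] [IsManifold I ∞ M] [T2Space M]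

/-- Every tangent vector extends to a smooth vector field. -/
lemma exists_smoothVField {p : M} (v : TangentSpace I p) :
    ∃ X : VField I M, SmoothVField X ∧ X p = v := by
  obtain ⟨s, hs, h⟩ := FiberBundle.exists_contMDiffOn_extend (k := ∞) I E v
  obtain ⟨u, hus, hu, hpu⟩ := mem_nhds_iff.1 hs
  obtain ⟨ψ, -, hψ⟩ :=
    (SmoothBumpFunction.nhds_basis_tsupport (I := I) p).mem_iff.1 (hu.mem_nhds hpu)
  refine ⟨fun q ↦ ψ q • FiberBundle.extend E v q, ?_, ?_⟩
  · exact ContMDiffOn.smul_section_of_tsupport (ψ.contMDiff.contMDiffOn) hu hψ (h.mono hus)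
  · simp

end Extension

section Algebra

variable {V : Type*} [AddCommGroup V] [Module ℝ V] [TopologicalSpace V]

/-- The pointwise identities satisfied by the covariant derivative `D x y = (∇_x φ) y` on an
almost contact complex Riemannian manifold. -/
structure IsStructureDerivative (φ : V →L[ℝ] V) (ξ : V) (η : V →L[ℝ] ℝ) (g : V →L[ℝ] V →L[ℝ] ℝ)
    (D : V → V →L[ℝ] V) : Prop where
  φ_ξ : φ ξ = 0
  φ_φ : ∀ v, φ (φ v) = -v + η v • ξ
  η_φ : ∀ v, η (φ v) = 0
  η_ξ : η ξ = 1
  symm : ∀ v w, g v w = g w v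
  nondegenerate : ∀ v, (∀ w, g v w = 0) → v = 0
  g_ξ : ∀ v, g v ξ = η v
  g_φ : ∀ v w, g (φ v) w = g v (φ w)
  add_left : ∀ x x' y, D (x + x') y = D x y + D x' y
  smul_left : ∀ (c : ℝ) x y, D (c • x) y = c • D x y
  selfAdjoint : ∀ x y z, g (D x y) z = g (D x z) y
  η_D_ξ : ∀ x, η (D x ξ) = 0
  deriv_φ_φ : ∀ x y, D x (φ y) + φ (D x y) = η (D x (φ y)) • ξ + η y • φ (D x ξ)

variable {φ : V →L[ℝ] V} {ξ : V} {η : V →L[ℝ] ℝ} {g : V →L[ℝ] V →L[ℝ] ℝ}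
  {D : V → V →L[ℝ] V}

namespace IsStructureDerivative

variable (h : IsStructureDerivative φ ξ η g D)
include h

lemma eq_of_forall {v w : V} (hvw : ∀ z, g v z = g w z) : v = w := by
  rw [← sub_eq_zero]
  refine h.nondegenerate _ fun z ↦ ?_
  simp [hvw]

lemma exists_horizontal (x : V) : ∃ x', η x' = 0 ∧ x = x' + η x • ξ :=
  ⟨x - η x • ξ, by simp [h.η_ξ], by simp⟩

/-- The components of the tensor `F` determine the covariant derivative of `φ`. -/
lemma eq_iff_components :
    (∀ x y, D x y = -(g x y • ξ) - η y • x + (2 * η x * η y) • ξ) ↔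
      ∀ x y z, η x = 0 → η y = 0 → η z = 0 →
        g (D x y) z = 0 ∧ g (D ξ y) z = 0 ∧ g (D ξ ξ) z = 0 ∧ g (D x y) ξ = -g x y := by
  have gξ (v : V) : g ξ v = η v := by rw [h.symm, h.g_ξ]
  constructor
  · intro hD x y z hx hy hz
    simp [hD, hx, hy, hz, gξ, h.η_ξ]
  · intro hF x y
    refine h.eq_of_forall fun z ↦ ?_
    obtain ⟨x', hx', ex⟩ := h.exists_horizontal x
    obtain ⟨y', hy', ey⟩ := h.exists_horizontal y
    obtain ⟨z', hz', ez⟩ := h.exists_horizontal z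
    obtain ⟨f1, f2, f3, f4⟩ := hF x' y' z' hx' hy' hz'
    obtain ⟨-, -, f5, f6⟩ := hF x' z' y' hx' hz' hy'
    have f7 := h.η_D_ξ x'
    have f8 := h.η_D_ξ ξ
    rw [h.g_ξ] at f4 f6
    have s1 := h.selfAdjoint x' ξ z'
    have s2 := h.selfAdjoint ξ ξ y'
    rw [h.g_ξ] at s1 s2
    generalize η x = a at *
    generalize η y = b at *
    generalize η z = c at *
    subst ex ey ez
    simp only [h.add_left, h.smul_left, map_add, map_smul, map_sub, map_neg, _root_.add_apply,
      _root_.sub_apply, _root_.neg_apply, _root_.smul_apply, smul_eq_mul, h.g_ξ, gξ, h.η_ξ, hx',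
      hy', hz', f1, f2, f3, f4, f5, f6, f7, f8, s1, ← s2]
    ring

/-- The covariant derivative of `φ` is determined by the sum of the two Nijenhuis tensors. -/
lemma eq_iff_nijenhuis :
    (∀ x y, D x y = -(g x y • ξ) - η y • x + (2 * η x * η y) • ξ) ↔
      ∀ x y, D (φ x) y - φ (D x y) + η (D x (φ y)) • ξ = -((2 * g x (φ y)) • ξ) := by
  have gξ (v : V) : g ξ v = η v := by rw [h.symm, h.g_ξ]
  constructor
  · intro hD x y
    simp only [hD, map_add, map_sub, map_neg, map_smul, h.φ_ξ, h.η_φ, h.η_ξ, h.g_φ]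
    simp only [smul_eq_mul]
    module
  · intro hP
    have hF (x y z : V) :
        g (D (φ x) y) z - g (D x y) (φ z) + η (D x (φ y)) * η z = -(2 * g x (φ y) * η z) := by
      have := congrArg (fun v ↦ g v z) (hP x y)
      simpa [gξ, h.g_φ] using this
    have hξ (x z : V) : η (D (φ x) z) = η (D x (φ z)) := by
      have h1 := hF x ξ z
      rw [h.φ_ξ] at h1
      rw [h.selfAdjoint (φ x) ξ z, h.selfAdjoint x ξ (φ z), h.g_ξ, h.g_ξ] at h1
      simp only [map_zero, mul_zero, zero_mul, add_zero, neg_zero] at h1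
      linarith
    have hφ (x y : V) : η (D x (φ y)) = -g x (φ y) := by
      have h1 := hF x y ξ
      simp only [h.φ_ξ, h.g_ξ, h.η_ξ, hξ, map_zero] at h1
      linarith
    have hφφ {v : V} (hv : η v = 0) : v = φ (-φ v) := by
      rw [map_neg, h.φ_φ, hv]; simp
    rw [h.eq_iff_components]
    intro x y z hx hy hz
    have key (u v : V) (hv : η v = 0) : g (D ξ u) v = 0 := by
      have h1 := hF ξ u (-φ v)
      have w0 : η (-φ v) = 0 := by simp [h.η_φ]
      have h0 : D 0 u = 0 := by simpa using h.smul_left 0 0 u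
      rw [← hφφ hv, h.φ_ξ, w0, h0, map_zero, _root_.zero_apply] at h1
      linarith
    refine ⟨?_, key y z hz, key ξ z hz, ?_⟩
    · have swap (w : V) (hw : η w = 0) : g (D x (φ y)) w = -g (D x y) (φ w) := by
        have h1 := congrArg (fun v ↦ g v w) (h.deriv_φ_φ x y)
        simp only [map_add, map_smul, _root_.add_apply, _root_.smul_apply, gξ, hw, hy, h.g_φ,
          smul_eq_mul, zero_mul, mul_zero, add_zero] at h1
        linarith
      have w0 : η (-φ z) = 0 := by simp [h.η_φ]
      have h1 := hF x y (-φ z)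
      have h2 := hF x (-φ z) y
      have h3 := swap (-φ z) w0
      rw [← hφφ hz, w0] at h1
      rw [← hφφ hz, hy] at h2
      rw [← hφφ hz] at h3
      have h4 := h.selfAdjoint (φ x) y (-φ z)
      have h5 := h.selfAdjoint x (-φ z) (φ y)
      linarith
    · have := hφ x (-φ y)
      rw [← hφφ hy] at this
      rw [h.g_ξ, this]

end IsStructureDerivative

end Algebra

section Geometry

variable {E : Type*} [NormedAddCommGroup E] [NormedSpace ℝ E]
  {H : Type*} [TopologicalSpace H] {I : ModelWithCorners ℝ E H}
  {M : Type*} [TopologicalSpace M] [ChartedSpace H M] [IsManifold I 1 M]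
  {n : ℕ} {φ : EndField I M} {ξ : VField I M} {η : OneForm I M} {g : BilinField I M} {p : M}

omit [IsManifold I 1 M] in
lemma deriveAlong_const (X : VField I M) (c : ℝ) : deriveAlong X (fun _ ↦ c) p = 0 := by
  rw [deriveAlong, mvfderiv_const]; rfl

namespace IsAlmostContactComplexRiemannian

variable (hM : IsAlmostContactComplexRiemannian n φ ξ η g)
include hM

lemma metric_ξ_right (v : TangentSpace I p) : g p v (ξ p) = η p v := by
  have := hM.compatible p v (ξ p)
  simp only [hM.φ_ξ, hM.η_ξ, map_zero] at this
  linarith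

lemma metric_ξ_left (v : TangentSpace I p) : g p (ξ p) v = η p v := by
  rw [hM.metric.symm, hM.metric_ξ_right]

lemma metric_φ_left (v w : TangentSpace I p) : g p (φ p v) w = g p v (φ p w) := by
  have := hM.compatible p v (φ p w)
  rw [hM.φ_φ, hM.η_φ, map_add, map_neg, map_smul, hM.metric_ξ_right, hM.η_φ] at this
  simp only [smul_eq_mul, mul_zero, add_zero] at this
  linarith

lemma diffAt_φ {X : VField I M} (hX : DiffAt X p) : DiffAt (fun q ↦ φ q (X q)) p :=
  hM.smooth_φ.diffAt hX

lemma diffAt_ξ : DiffAt ξ p := hM.smooth_ξ.diffAt p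

variable [IsManifold I 2 M] [FiniteDimensional ℝ E]

lemma η_leviCivita_ξ {X : VField I M} (hX : DiffAt X p) : η p (leviCivita g X ξ p) = 0 := by
  have h := deriveAlong_pairing hM.metric hX hM.diffAt_ξ hM.diffAt_ξ
  have e : pairing g ξ ξ = fun _ ↦ 1 := by
    ext q; simp [pairing, hM.metric_ξ_left, hM.η_ξ]
  rw [e, hM.metric_ξ_left, hM.metric_ξ_right] at h
  rw [deriveAlong_const] at h
  linarith

lemma covDerivEnd_ξ {X : VField I M} (hX : DiffAt X p) :
    covDerivEnd g φ X ξ p = -φ p (leviCivita g X ξ p) := by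
  have e : (fun q ↦ φ q (ξ q)) = (fun _ : M ↦ (0 : ℝ)) • ξ := by
    ext q; simp [hM.φ_ξ]
  rw [covDerivEnd, e, leviCivita_smul_right hM.metric mdifferentiableAt_const hX hM.diffAt_ξ]
  simp [deriveAlong_const]

lemma leviCivita_ξ {X : VField I M} (hX : DiffAt X p) :
    leviCivita g X ξ p = φ p (covDerivEnd g φ X ξ p) := by
  simp [hM.covDerivEnd_ξ hX, hM.φ_φ, hM.η_leviCivita_ξ hX]

lemma deriveAlong_η {X Y : VField I M} (hX : DiffAt X p) (hY : DiffAt Y p) :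
    deriveAlong X (fun q ↦ η q (Y q)) p
      = g p (leviCivita g X ξ p) (Y p) + η p (leviCivita g X Y p) := by
  have h := deriveAlong_pairing hM.metric hX hM.diffAt_ξ hY
  have e : pairing g ξ Y = fun q ↦ η q (Y q) := by
    ext q; simp [pairing, hM.metric_ξ_left]
  rwa [e, hM.metric_ξ_left] at h

lemma covDerivEnd_selfAdjoint {X Y Z : VField I M} (hX : DiffAt X p) (hY : DiffAt Y p)
    (hZ : DiffAt Z p) :
    g p (covDerivEnd g φ X Y p) (Z p) = g p (covDerivEnd g φ X Z p) (Y p) := by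
  have h1 := deriveAlong_pairing hM.metric hX (hM.diffAt_φ hY) hZ
  have h2 := deriveAlong_pairing hM.metric hX hY (hM.diffAt_φ hZ)
  have e : pairing g (fun q ↦ φ q (Y q)) Z = pairing g Y (fun q ↦ φ q (Z q)) := by
    ext q; simp [pairing, hM.metric_φ_left]
  rw [e, h2] at h1
  rw [hM.metric.symm p (Y p)] at h1
  simp only [covDerivEnd, map_sub, _root_.sub_apply, hM.metric_φ_left] at h1 ⊢
  rw [hM.metric.symm p (Y p) (φ p (leviCivita g X Z p)), hM.metric_φ_left] at h1
  linarith

lemma metric_leviCivita_ξ {X Y : VField I M} (hX : DiffAt X p) (hY : DiffAt Y p) :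
    g p (leviCivita g X ξ p) (Y p) = η p (covDerivEnd g φ X (fun q ↦ φ q (Y q)) p) := by
  rw [hM.leviCivita_ξ hX, hM.metric_φ_left,
    hM.covDerivEnd_selfAdjoint hX hM.diffAt_ξ (hM.diffAt_φ hY), hM.metric_ξ_right]

lemma covDerivEnd_φ_φ {X Y : VField I M} (hX : DiffAt X p) (hY : DiffAt Y p) :
    covDerivEnd g φ X (fun q ↦ φ q (Y q)) p + φ p (covDerivEnd g φ X Y p)
      = η p (covDerivEnd g φ X (fun q ↦ φ q (Y q)) p) • ξ p
        + η p (Y p) • φ p (covDerivEnd g φ X ξ p) := by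
  have e : (fun q ↦ φ q (φ q (Y q))) = (fun _ : M ↦ (-1 : ℝ)) • Y + (fun q ↦ η q (Y q)) • ξ := by
    ext q; simp [hM.φ_φ]
  have hη := hM.smooth_η.mdifferentiableAt hY
  have hc : MDifferentiableAt I 𝓘(ℝ, ℝ) (fun _ : M ↦ (-1 : ℝ)) p := mdifferentiableAt_const
  have h : leviCivita g X (fun q ↦ φ q (φ q (Y q))) p = -leviCivita g X Y p
      + (g p (leviCivita g X ξ p) (Y p) + η p (leviCivita g X Y p)) • ξ p
      + η p (Y p) • leviCivita g X ξ p := by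
    rw [e, leviCivita_add_right hM.metric hX (hY.smul hc) (hM.diffAt_ξ.smul hη),
      leviCivita_smul_right hM.metric hc hX hY,
      leviCivita_smul_right hM.metric hη hX hM.diffAt_ξ, hM.deriveAlong_η hX hY]
    simp [deriveAlong_const]
    module
  rw [← hM.leviCivita_ξ hX, ← hM.metric_leviCivita_ξ hX hY]
  simp only [covDerivEnd, h, map_sub]
  rw [hM.φ_φ p (leviCivita g X Y p)]
  module

lemma isStructureDerivative (p : M) : IsStructureDerivative (φ p) (ξ p) (η p) (g p)
    (fun v ↦ covDerivEndAt hM.metric hM.smooth_φ p v) := by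
  have ext (v : TangentSpace I p) : ∃ X : VField I M, DiffAt X p ∧ X p = v :=
    ⟨_, FiberBundle.mdifferentiableAt_extend I E v, by simp⟩
  exact
  { φ_ξ := hM.φ_ξ p
    φ_φ := hM.φ_φ p
    η_φ := hM.η_φ p
    η_ξ := hM.η_ξ p
    symm := hM.metric.symm p
    nondegenerate := hM.metric.nondegenerate p
    g_ξ := hM.metric_ξ_right
    g_φ := hM.metric_φ_left
    add_left := by simp
    smul_left := by simp
    selfAdjoint := by
      intro x y z
      obtain ⟨X, hX, rfl⟩ := ext x
      obtain ⟨Y, hY, rfl⟩ := ext y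
      obtain ⟨Z, hZ, rfl⟩ := ext z
      simp only [covDerivEndAt_apply hM.metric hM.smooth_φ hX hY,
        covDerivEndAt_apply hM.metric hM.smooth_φ hX hZ]
      exact hM.covDerivEnd_selfAdjoint hX hY hZ
    η_D_ξ := by
      intro x
      obtain ⟨X, hX, rfl⟩ := ext x
      simp only [covDerivEndAt_apply hM.metric hM.smooth_φ hX hM.diffAt_ξ]
      rw [hM.covDerivEnd_ξ hX, map_neg, hM.η_φ, neg_zero]
    deriv_φ_φ := by
      intro x y
      obtain ⟨X, hX, rfl⟩ := ext x
      obtain ⟨Y, hY, rfl⟩ := ext y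
      have := covDerivEndAt_apply hM.metric hM.smooth_φ hX (hM.diffAt_φ hY)
      simp only [covDerivEndAt_apply hM.metric hM.smooth_φ hX hM.diffAt_ξ,
        covDerivEndAt_apply hM.metric hM.smooth_φ hX hY, this]
      exact hM.covDerivEnd_φ_φ hX hY }

lemma nijenhuis_eq {X Y : VField I M} (hX : DiffAt X p) (hY : DiffAt Y p) :
    nijenhuis φ ξ η X Y p =
      (covDerivEnd g φ (fun q ↦ φ q (X q)) Y p - φ p (covDerivEnd g φ X Y p)
        + η p (covDerivEnd g φ X (fun q ↦ φ q (Y q)) p) • ξ p)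
      - (covDerivEnd g φ (fun q ↦ φ q (Y q)) X p - φ p (covDerivEnd g φ Y X p)
        + η p (covDerivEnd g φ Y (fun q ↦ φ q (X q)) p) • ξ p) := by
  have hφX := hM.diffAt_φ hX
  have hφY := hM.diffAt_φ hY
  rw [nijenhuis, dEta, hM.deriveAlong_η hX hY, hM.deriveAlong_η hY hX,
    hM.metric_leviCivita_ξ hX hY, hM.metric_leviCivita_ξ hY hX,
    ← leviCivita_sub_swap hM.metric hφX hφY, ← leviCivita_sub_swap hM.metric hφX hY,
    ← leviCivita_sub_swap hM.metric hX hφY, ← leviCivita_sub_swap hM.metric hX hY]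
  simp only [covDerivEnd, map_sub]
  module

lemma assocNijenhuis_eq {X Y : VField I M} (hX : DiffAt X p) (hY : DiffAt Y p) :
    assocNijenhuis φ ξ g X Y p =
      (covDerivEnd g φ (fun q ↦ φ q (X q)) Y p - φ p (covDerivEnd g φ X Y p)
        + η p (covDerivEnd g φ X (fun q ↦ φ q (Y q)) p) • ξ p)
      + (covDerivEnd g φ (fun q ↦ φ q (Y q)) X p - φ p (covDerivEnd g φ Y X p)
        + η p (covDerivEnd g φ Y (fun q ↦ φ q (X q)) p) • ξ p) := by
  have hL : lieDerivMetric ξ g X Y p = η p (covDerivEnd g φ X (fun q ↦ φ q (Y q)) p)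
      + η p (covDerivEnd g φ Y (fun q ↦ φ q (X q)) p) := by
    rw [lieDerivMetric, deriveAlong_pairing hM.metric hM.diffAt_ξ hX hY, pairing, pairing,
      ← leviCivita_sub_swap hM.metric hM.diffAt_ξ hX,
      ← leviCivita_sub_swap hM.metric hM.diffAt_ξ hY,
      ← hM.metric_leviCivita_ξ hX hY, ← hM.metric_leviCivita_ξ hY hX,
      hM.metric.symm p _ (X p)]
    simp only [map_sub, _root_.sub_apply]
    rw [hM.metric.symm p (X p) (leviCivita g Y ξ p)]
    ring
  rw [assocNijenhuis, hL]
  simp only [covDerivEnd, symmBracket, map_sub, map_add]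
  module

end IsAlmostContactComplexRiemannian

end Geometry

section Equivalences

variable {E : Type*} [NormedAddCommGroup E] [NormedSpace ℝ E] [FiniteDimensional ℝ E]
  {H : Type*} [TopologicalSpace H] {I : ModelWithCorners ℝ E H}
  {M : Type*} [TopologicalSpace M] [ChartedSpace H M] [IsManifold I ∞ M] [T2Space M]
  {n : ℕ} {φ : EndField I M} {ξ : VField I M} {η : OneForm I M} {g : BilinField I M}

/-- The formula for `∇φ` characterizing Sasaki-like manifolds. -/
def HasSasakiLikeDerivative (φ : EndField I M) (ξ : VField I M) (η : OneForm I M)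
    (g : BilinField I M) : Prop :=
  ∀ X Y : VField I M, SmoothVField X → SmoothVField Y → ∀ p, covDerivEnd g φ X Y p =
    -(g p (X p) (Y p) • ξ p) - η p (Y p) • X p + (2 * η p (X p) * η p (Y p)) • ξ p

namespace IsAlmostContactComplexRiemannian

variable (hM : IsAlmostContactComplexRiemannian n φ ξ η g)
include hM

lemma hasSasakiLikeDerivative_iff : HasSasakiLikeDerivative φ ξ η g ↔
    ∀ p, ∀ x y : TangentSpace I p, covDerivEndAt hM.metric hM.smooth_φ p x y =
      -(g p x y • ξ p) - η p y • x + (2 * η p x * η p y) • ξ p := by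
  constructor
  · intro h p x y
    obtain ⟨X, hX, rfl⟩ := exists_smoothVField x
    obtain ⟨Y, hY, rfl⟩ := exists_smoothVField y
    rw [covDerivEndAt_apply hM.metric hM.smooth_φ (hX.diffAt p) (hY.diffAt p), h X Y hX hY]
  · intro h X Y hX hY p
    rw [← covDerivEndAt_apply hM.metric hM.smooth_φ (hX.diffAt p) (hY.diffAt p), h]

lemma exists_smoothHorizontal {p : M} {x : TangentSpace I p} (hx : η p x = 0) :
    ∃ X : VField I M, SmoothHorizontal η X ∧ X p = x := by
  obtain ⟨X, hX, rfl⟩ := exists_smoothVField x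
  refine ⟨fun q ↦ φ q (-φ q (X q)), ⟨?_, fun q ↦ hM.η_φ q _⟩, by simp [hM.φ_φ, hx]⟩
  exact hM.smooth_φ.smooth (ContMDiff.neg_section (hM.smooth_φ.smooth hX))

lemma hasSasakiLikeDerivative_iff_tensorConditions :
    HasSasakiLikeDerivative φ ξ η g ↔ SasakiLikeTensorConditions φ ξ η g := by
  rw [hM.hasSasakiLikeDerivative_iff,
    forall_congr' fun p ↦ (hM.isStructureDerivative p).eq_iff_components]
  have e {p : M} {X Y : VField I M} (hX : SmoothVField X) (hY : SmoothVField Y) :=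
    covDerivEndAt_apply hM.metric hM.smooth_φ (hX.diffAt p) (hY.diffAt p)
  constructor
  · intro h X Y Z hX hY hZ p
    have := h p (X p) (Y p) (Z p) (hX.2 p) (hY.2 p) (hZ.2 p)
    rwa [e hX.1 hY.1, e hM.smooth_ξ hY.1, e hM.smooth_ξ hM.smooth_ξ] at this
  · intro h p x y z hx hy hz
    obtain ⟨X, hX, rfl⟩ := hM.exists_smoothHorizontal hx
    obtain ⟨Y, hY, rfl⟩ := hM.exists_smoothHorizontal hy
    obtain ⟨Z, hZ, rfl⟩ := hM.exists_smoothHorizontal hz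
    rw [e hX.1 hY.1, e hM.smooth_ξ hY.1, e hM.smooth_ξ hM.smooth_ξ]
    exact h X Y Z hX hY hZ p

lemma hasSasakiLikeDerivative_iff_nijenhuis :
    HasSasakiLikeDerivative φ ξ η g ↔
      ∀ X Y : VField I M, SmoothVField X → SmoothVField Y → ∀ p,
        nijenhuis φ ξ η X Y p = 0 ∧
        assocNijenhuis φ ξ g X Y p =
          -((4 * (associatedMetric φ η g p (X p) (Y p) - η p (X p) * η p (Y p))) • ξ p) := by
  rw [hM.hasSasakiLikeDerivative_iff,
    forall_congr' fun p ↦ (hM.isStructureDerivative p).eq_iff_nijenhuis]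
  have e {p : M} {X Y : VField I M} (hX : SmoothVField X) (hY : SmoothVField Y) :=
    covDerivEndAt_apply hM.metric hM.smooth_φ (hX.diffAt p) (hY.diffAt p)
  have s {X : VField I M} (hX : SmoothVField X) := hM.smooth_φ.smooth hX
  constructor
  · intro h X Y hX hY p
    have h1 := h p (X p) (Y p)
    have h2 := h p (Y p) (X p)
    rw [e hX hY, e hX (s hY), e (s hX) hY] at h1
    rw [e hY hX, e hY (s hX), e (s hY) hX] at h2
    rw [hM.nijenhuis_eq (hX.diffAt p) (hY.diffAt p), hM.assocNijenhuis_eq (hX.diffAt p)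
      (hY.diffAt p), h1, h2, ← hM.metric_φ_left, hM.metric.symm p (Y p) (φ p (X p)),
      associatedMetric, ← hM.metric_φ_left]
    constructor <;> module
  · intro h p x y
    obtain ⟨X, hX, rfl⟩ := exists_smoothVField x
    obtain ⟨Y, hY, rfl⟩ := exists_smoothVField y
    obtain ⟨h1, h2⟩ := h X Y hX hY p
    rw [hM.nijenhuis_eq (hX.diffAt p) (hY.diffAt p)] at h1
    rw [hM.assocNijenhuis_eq (hX.diffAt p) (hY.diffAt p), associatedMetric] at h2
    rw [e hX hY, e hX (s hY), e (s hX) hY]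
    have h3 := congrArg₂ (fun a b ↦ (1 / 2 : ℝ) • a + (1 / 2 : ℝ) • b) h1 h2
    refine Eq.trans ?_ (h3.trans ?_) <;> module

end IsAlmostContactComplexRiemannian

end Equivalences

section Product

open VectorField Set Topology

lemma inverse_prodMap {E₁ E₂ F₁ F₂ : Type*} [AddCommGroup E₁] [Module ℝ E₁] [TopologicalSpace E₁]
    [AddCommGroup E₂] [Module ℝ E₂] [TopologicalSpace E₂]
    [AddCommGroup F₁] [Module ℝ F₁] [TopologicalSpace F₁]
    [AddCommGroup F₂] [Module ℝ F₂] [TopologicalSpace F₂]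
    {A : E₁ →L[ℝ] F₁} {B : E₂ →L[ℝ] F₂} (hA : A.IsInvertible) (hB : B.IsInvertible) :
    (A.prodMap B).inverse = A.inverse.prodMap B.inverse := by
  apply ContinuousLinearMap.inverse_eq
  · ext x <;> simp [hA.self_apply_inverse, hB.self_apply_inverse]
  · ext x <;> simp [hA.inverse_apply_self, hB.inverse_apply_self]

lemma lieBracketWithin_prodMap {E F : Type*} [NormedAddCommGroup E] [NormedSpace ℝ E]
    [NormedAddCommGroup F] [NormedSpace ℝ F] {V V' : E → E} {W W' : F → F} {s : Set E} {t : Set F}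
    {x : E × F} (hV : DifferentiableWithinAt ℝ V s x.1) (hV' : DifferentiableWithinAt ℝ V' s x.1)
    (hW : DifferentiableWithinAt ℝ W t x.2) (hW' : DifferentiableWithinAt ℝ W' t x.2)
    (hs : UniqueDiffWithinAt ℝ s x.1) (ht : UniqueDiffWithinAt ℝ t x.2) :
    lieBracketWithin ℝ (Prod.map V W) (Prod.map V' W') (s ×ˢ t) x
      = (lieBracketWithin ℝ V V' s x.1, lieBracketWithin ℝ W W' t x.2) := by
  have key {V : E → E} {W : F → F} (hV : DifferentiableWithinAt ℝ V s x.1)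
      (hW : DifferentiableWithinAt ℝ W t x.2) :
      fderivWithin ℝ (Prod.map V W) (s ×ˢ t) x
        = (fderivWithin ℝ V s x.1).prodMap (fderivWithin ℝ W t x.2) := by
    apply HasFDerivWithinAt.fderivWithin _ (hs.prod ht)
    exact HasFDerivWithinAt.prodMap x (hV.hasFDerivWithinAt.mono (fst_image_prod_subset ..))
      (hW.hasFDerivWithinAt.mono (snd_image_prod_subset ..))
  simp only [lieBracketWithin, key hV hW, key hV' hW']
  rfl

variable {E : Type*} [NormedAddCommGroup E] [NormedSpace ℝ E]
  {H : Type*} [TopologicalSpace H] {I : ModelWithCorners ℝ E H}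
  {M : Type*} [TopologicalSpace M] [ChartedSpace H M]
  {E' : Type*} [NormedAddCommGroup E'] [NormedSpace ℝ E']
  {H' : Type*} [TopologicalSpace H'] {I' : ModelWithCorners ℝ E' H'}
  {M' : Type*} [TopologicalSpace M'] [ChartedSpace H' M']

/-- The product of two vector fields. -/
def prodField (V : VField I M) (W : VField I' M') : VField (I.prod I') (M × M') :=
  fun p ↦ (V p.1, W p.2)

@[simp] lemma prodField_zero_zero : prodField (0 : VField I M) (0 : VField I' M') = 0 := rfl

lemma mpullbackWithin_extChartAt_symm_prodField [IsManifold I 1 M] [IsManifold I' 1 M']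
    (V : VField I M) (W : VField I' M') (p : M × M') {u : E × E'}
    (hu : u ∈ (extChartAt (I.prod I') p).target) :
    mpullbackWithin 𝓘(ℝ, E × E') (I.prod I') (extChartAt (I.prod I') p).symm
        (prodField V W) (range (I.prod I')) u
      = (mpullbackWithin 𝓘(ℝ, E) I (extChartAt I p.1).symm V (range I) u.1,
          mpullbackWithin 𝓘(ℝ, E') I' (extChartAt I' p.2).symm W (range I') u.2) := by
  rw [extChartAt_prod] at hu
  have hu1 : u.1 ∈ (extChartAt I p.1).target := hu.1
  have hu2 : u.2 ∈ (extChartAt I' p.2).target := hu.2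
  have d1 : MDifferentiableWithinAt 𝓘(ℝ, E) I (extChartAt I p.1).symm (range I) u.1 :=
    (contMDiffWithinAt_extChartAt_symm_range (n := 1) p.1 hu1).mdifferentiableWithinAt one_ne_zero
  have d2 : MDifferentiableWithinAt 𝓘(ℝ, E') I' (extChartAt I' p.2).symm (range I') u.2 :=
    (contMDiffWithinAt_extChartAt_symm_range (n := 1) p.2 hu2).mdifferentiableWithinAt one_ne_zero
  have D : mfderivWithin 𝓘(ℝ, E × E') (I.prod I') (extChartAt (I.prod I') p).symm
      (range (I.prod I')) u
      = (mfderivWithin 𝓘(ℝ, E) I (extChartAt I p.1).symm (range I) u.1).prodMap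
        (mfderivWithin 𝓘(ℝ, E') I' (extChartAt I' p.2).symm (range I') u.2) := by
    rw [extChartAt_prod, modelWithCornersSelf_prod, ← chartedSpaceSelf_prod,
      ModelWithCorners.range_prod]
    exact mfderivWithin_prodMap d1 d2 (I.uniqueMDiffOn _ ((extChartAt_target_subset_range p.1) hu1))
      (I'.uniqueMDiffOn _ ((extChartAt_target_subset_range p.2) hu2))
  have D' := (congrArg ContinuousLinearMap.inverse D).trans
    (inverse_prodMap (isInvertible_mfderivWithin_extChartAt_symm hu1)
      (isInvertible_mfderivWithin_extChartAt_symm hu2))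
  have e : (extChartAt (I.prod I') p).symm u
      = ((extChartAt I p.1).symm u.1, (extChartAt I' p.2).symm u.2) := by
    rw [extChartAt_prod]; rfl
  exact congrArg (fun A : E × E' →L[ℝ] E × E' ↦
    A (prodField V W ((extChartAt (I.prod I') p).symm u))) D'

lemma mlieBracket_eq_lieBracketWithin (V W : VField I M) (x : M) :
    mlieBracket I V W x = (mfderiv I 𝓘(ℝ, E) (extChartAt I x) x).inverse
      (lieBracketWithin (E := E) ℝ
        (mpullbackWithin 𝓘(ℝ, E) I (extChartAt I x).symm V (range I))
        (mpullbackWithin 𝓘(ℝ, E) I (extChartAt I x).symm W (range I))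
        (range I) (extChartAt I x x)) := by
  rw [← mlieBracketWithin_univ, mlieBracketWithin_apply, preimage_univ, univ_inter]

lemma DiffAt.differentiableWithinAt [IsManifold I 1 M] [IsManifold I 2 M] [CompleteSpace E]
    {V : VField I M} {x : M} (hV : DiffAt V x) :
    DifferentiableWithinAt ℝ (mpullbackWithin 𝓘(ℝ, E) I (extChartAt I x).symm V (range I))
      (range I) (extChartAt I x x) := by
  have := MDifferentiableWithinAt.differentiableWithinAt_mpullbackWithin_vectorField
    (s := univ) (mdifferentiableWithinAt_univ.2 hV)
  rwa [preimage_univ, univ_inter] at this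

/-- The Lie bracket of products of vector fields is the product of the Lie brackets. -/
lemma mlieBracket_prodField [IsManifold I 1 M] [IsManifold I' 1 M'] [IsManifold I 2 M]
    [IsManifold I' 2 M'] [CompleteSpace E] [CompleteSpace E'] {V V' : VField I M}
    {W W' : VField I' M'} {p : M × M'}
    (hV : DiffAt V p.1) (hV' : DiffAt V' p.1) (hW : DiffAt W p.2) (hW' : DiffAt W' p.2) :
    mlieBracket (I.prod I') (prodField V W) (prodField V' W') p
      = prodField (mlieBracket I V V') (mlieBracket I' W W') p := by
  have m1 : MDifferentiableAt I 𝓘(ℝ, E) (extChartAt I p.1) p.1 :=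
    mdifferentiableAt_extChartAt (mem_chart_source H p.1)
  have m2 : MDifferentiableAt I' 𝓘(ℝ, E') (extChartAt I' p.2) p.2 :=
    mdifferentiableAt_extChartAt (mem_chart_source H' p.2)
  have D : mfderiv (I.prod I') 𝓘(ℝ, E × E') (extChartAt (I.prod I') p) p
      = (mfderiv I 𝓘(ℝ, E) (extChartAt I p.1) p.1).prodMap
        (mfderiv I' 𝓘(ℝ, E') (extChartAt I' p.2) p.2) := by
    rw [extChartAt_prod, modelWithCornersSelf_prod, ← chartedSpaceSelf_prod]
    exact mfderiv_prodMap m1 m2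
  have D' := (congrArg ContinuousLinearMap.inverse D).trans
    (inverse_prodMap (isInvertible_mfderiv_extChartAt (mem_extChartAt_source p.1))
      (isInvertible_mfderiv_extChartAt (mem_extChartAt_source p.2)))
  have hE (V : VField I M) (W : VField I' M') :
      mpullbackWithin 𝓘(ℝ, E × E') (I.prod I') (extChartAt (I.prod I') p).symm
        (prodField V W) (range (I.prod I')) =ᶠ[𝓝[range (I.prod I')] (extChartAt (I.prod I') p p)]
      Prod.map (mpullbackWithin 𝓘(ℝ, E) I (extChartAt I p.1).symm V (range I))
        (mpullbackWithin 𝓘(ℝ, E') I' (extChartAt I' p.2).symm W (range I')) := by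
    filter_upwards [extChartAt_target_mem_nhdsWithin (I := I.prod I') p] with u hu
    exact mpullbackWithin_extChartAt_symm_prodField V W p hu
  have hx (V : VField I M) (W : VField I' M') :=
    mpullbackWithin_extChartAt_symm_prodField V W p (mem_extChartAt_target (I := I.prod I') p)
  have B : lieBracketWithin ℝ
      (mpullbackWithin 𝓘(ℝ, E × E') (I.prod I') (extChartAt (I.prod I') p).symm
        (prodField V W) (range (I.prod I')))
      (mpullbackWithin 𝓘(ℝ, E × E') (I.prod I') (extChartAt (I.prod I') p).symm
        (prodField V' W') (range (I.prod I')))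
      (range (I.prod I')) (extChartAt (I.prod I') p p)
      = (lieBracketWithin (E := E) ℝ
          (mpullbackWithin 𝓘(ℝ, E) I (extChartAt I p.1).symm V (range I))
          (mpullbackWithin 𝓘(ℝ, E) I (extChartAt I p.1).symm V' (range I))
          (range I) (extChartAt I p.1 p.1),
        lieBracketWithin (E := E') ℝ
          (mpullbackWithin 𝓘(ℝ, E') I' (extChartAt I' p.2).symm W (range I'))
          (mpullbackWithin 𝓘(ℝ, E') I' (extChartAt I' p.2).symm W' (range I'))
          (range I') (extChartAt I' p.2 p.2)) :=
    ((hE V W).lieBracketWithin_vectorField_eq (hx V W) (hE V' W') (hx V' W')).trans <| by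
      rw [ModelWithCorners.range_prod]
      exact lieBracketWithin_prodMap hV.differentiableWithinAt hV'.differentiableWithinAt
        hW.differentiableWithinAt hW'.differentiableWithinAt
        (I.uniqueDiffOn _ (mem_range_self _)) (I'.uniqueDiffOn _ (mem_range_self _))
  rw [mlieBracket_eq_lieBracketWithin]
  exact (congrArg₂ (fun (A : E × E' →L[ℝ] E × E') v ↦ A v) D' B).trans
    (Prod.ext (mlieBracket_eq_lieBracketWithin V V' p.1).symm
      (mlieBracket_eq_lieBracketWithin W W' p.2).symm)

end Product

section ProductSmooth

variable {E : Type*} [NormedAddCommGroup E] [NormedSpace ℝ E]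
  {H : Type*} [TopologicalSpace H] {I : ModelWithCorners ℝ E H}
  {M : Type*} [TopologicalSpace M] [ChartedSpace H M] [IsManifold I 1 M]
  {E' : Type*} [NormedAddCommGroup E'] [NormedSpace ℝ E']
  {H' : Type*} [TopologicalSpace H'] {I' : ModelWithCorners ℝ E' H'}
  {M' : Type*} [TopologicalSpace M'] [ChartedSpace H' M'] [IsManifold I' 1 M']

variable (I M) in
lemma smoothVField_zero : SmoothVField (0 : VField I M) :=
  contMDiff_zeroSection ℝ (TangentSpace I : M → Type _)

lemma SmoothVField.prodField {V : VField I M} {W : VField I' M'} (hV : SmoothVField V)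
    (hW : SmoothVField W) : SmoothVField (prodField V W) :=
  contMDiff_equivTangentBundleProd_symm.comp (ContMDiff.prodMap hV hW)

lemma DiffAt.prodField {V : VField I M} {W : VField I' M'} {p : M × M'} (hV : DiffAt V p.1)
    (hW : DiffAt W p.2) : DiffAt (prodField V W) p :=
  (contMDiff_equivTangentBundleProd_symm (n := 1)).mdifferentiable one_ne_zero _ |>.comp p
    (MDifferentiableAt.prodMap' hV hW)

end ProductSmooth

section NegReals

lemma hasMFDerivAt_negReals_val (r : negReals) :
    HasMFDerivAt 𝓘(ℝ, ℝ) 𝓘(ℝ, ℝ) (Subtype.val : negReals → ℝ) r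
      (ContinuousLinearMap.id ℝ ℝ) := by
  refine ⟨continuous_subtype_val.continuousAt, ?_⟩
  refine (hasFDerivAt_id _).hasFDerivWithinAt.congr_of_eventuallyEq ?_ ?_
  · have h :=
      TopologicalSpace.Opens.chartAt_subtype_val_symm_eventuallyEq (H := ℝ) negReals (x := r)
    rw [chartAt_self_eq] at h
    exact h.symm.filter_mono nhdsWithin_le_nhds
  · simp
    rfl

lemma mfderiv_negReals_val (r : negReals) :
    mfderiv 𝓘(ℝ, ℝ) 𝓘(ℝ, ℝ) (Subtype.val : negReals → ℝ) r = ContinuousLinearMap.id ℝ ℝ :=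
  (hasMFDerivAt_negReals_val r).mfderiv

/-- The vector field `r d/dr` on the half-line of negative reals. -/
def eulerField : VField 𝓘(ℝ, ℝ) negReals := fun r ↦ (r : ℝ)

lemma smoothVField_eulerField : SmoothVField eulerField := by
  have h : ContMDiff 𝓘(ℝ, ℝ) 𝓘(ℝ, ℝ).tangent ∞
      (fun x : ℝ ↦ (⟨x, x⟩ : TangentBundle 𝓘(ℝ, ℝ) ℝ)) :=
    contMDiff_vectorSpace_iff_contDiff.2 contDiff_id
  have hi (r : negReals) :
      (mfderiv 𝓘(ℝ, ℝ) 𝓘(ℝ, ℝ) (Subtype.val : negReals → ℝ) r).IsInvertible := by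
    rw [mfderiv_negReals_val]; exact ⟨ContinuousLinearEquiv.refl ℝ ℝ, rfl⟩
  have := ContMDiff.mpullback_vectorField (I := 𝓘(ℝ, ℝ)) (M := negReals) (n := ∞) h
    (contMDiff_subtype_val (U := negReals)) hi (by simp)
  have e (r : negReals) : VectorField.mpullback 𝓘(ℝ, ℝ) 𝓘(ℝ, ℝ) (Subtype.val : negReals → ℝ)
      (fun x : ℝ ↦ x) r = eulerField r := by
    exact (congrArg (fun A : ℝ →L[ℝ] ℝ ↦ A.inverse r) (mfderiv_negReals_val r)).trans
      (congrArg (fun A : ℝ →L[ℝ] ℝ ↦ A r) ContinuousLinearMap.inverse_id)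
  simpa only [e] using! this

end NegReals

section Cone

variable {E : Type*} [NormedAddCommGroup E] [NormedSpace ℝ E]
  {H : Type*} [TopologicalSpace H] {I : ModelWithCorners ℝ E H}
  {M : Type*} [TopologicalSpace M] [ChartedSpace H M]

/-- The vector field `X + u r d/dr` on the cone. -/
def coneField (X : VField I M) (u : M → ℝ) : VField (I.prod 𝓘(ℝ, ℝ)) (Cone M) :=
  fun p ↦ (X p.1, (u p.1 * p.2 : ℝ))

section Components

variable {p : Cone M}

/-- A tangent vector of the cone is determined by its components. -/
lemma cone_tangent_ext {a b : TangentSpace (I.prod 𝓘(ℝ, ℝ)) p} (h : horiz p a = horiz p b)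
    (h' : radial p a = radial p b) : a = b :=
  Prod.ext h h'

@[simp] lemma horiz_prodField (X : VField I M) (W : VField 𝓘(ℝ, ℝ) negReals) :
    horiz p (prodField X W p) = X p.1 := rfl

@[simp] lemma radial_prodField_zero (X : VField I M) :
    radial p (prodField X (0 : VField 𝓘(ℝ, ℝ) negReals) p) = 0 := rfl

@[simp] lemma radial_prodField_eulerField (X : VField I M) :
    radial p (prodField X eulerField p) = p.2 := rfl

@[simp] lemma horiz_coneField (X : VField I M) (u : M → ℝ) :
    horiz p (coneField X u p) = X p.1 := rfl

@[simp] lemma radial_coneField (X : VField I M) (u : M → ℝ) :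
    radial p (coneField X u p) = u p.1 * p.2 := rfl

lemma coneField_eq (X : VField I M) (u : M → ℝ) :
    coneField X u = prodField X 0 + (fun p : Cone M ↦ u p.1) • prodField 0 eulerField := by
  ext1 p
  apply cone_tangent_ext <;> simp

variable {u v : M → ℝ}

lemma mdifferentiableAt_comp_fst (hu : MDifferentiableAt I 𝓘(ℝ, ℝ) u p.1) :
    MDifferentiableAt (I.prod 𝓘(ℝ, ℝ)) 𝓘(ℝ, ℝ) (fun p : Cone M ↦ u p.1) p :=
  hu.comp p mdifferentiableAt_fst

lemma mvfderiv_comp_fst (hu : MDifferentiableAt I 𝓘(ℝ, ℝ) u p.1)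
    (w : TangentSpace (I.prod 𝓘(ℝ, ℝ)) p) :
    mvfderiv (I.prod 𝓘(ℝ, ℝ)) (fun p : Cone M ↦ u p.1) p w = mvfderiv I u p.1 (horiz p w) := by
  have h : mfderiv (I.prod 𝓘(ℝ, ℝ)) 𝓘(ℝ, ℝ) (fun p : Cone M ↦ u p.1) p = _ :=
    mfderiv_comp p hu mdifferentiableAt_fst
  rw [mfderiv_fst] at h
  rw [mvfderiv, h]
  rfl

lemma hasMFDerivAt_radius : HasMFDerivAt (I.prod 𝓘(ℝ, ℝ)) 𝓘(ℝ, ℝ)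
    (fun p : Cone M ↦ (p.2 : ℝ)) p (radial p) :=
  (hasMFDerivAt_negReals_val p.2).comp p (hasMFDerivAt_snd p)

lemma mvfderiv_radius (w : TangentSpace (I.prod 𝓘(ℝ, ℝ)) p) :
    mvfderiv (I.prod 𝓘(ℝ, ℝ)) (fun p : Cone M ↦ (p.2 : ℝ)) p w = radial p w := by
  rw [mvfderiv, hasMFDerivAt_radius.mfderiv]
  rfl

end Components

variable [IsManifold I 1 M]

lemma SmoothVField.coneField {X : VField I M} {u : M → ℝ} (hX : SmoothVField X)
    (hu : ContMDiff I 𝓘(ℝ, ℝ) ∞ u) : SmoothVField (coneField X u) := by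
  rw [coneField_eq]
  have h0 := smoothVField_zero I M
  have h0' := smoothVField_zero 𝓘(ℝ, ℝ) negReals
  exact ContMDiff.add_section (hX.prodField h0')
    ((hu.comp contMDiff_fst).smul_section (h0.prodField smoothVField_eulerField))

variable {p : Cone M} {X Y : VField I M} {u v : M → ℝ}

lemma diffAt_prodField_zero_left : DiffAt (prodField (0 : VField I M) eulerField) p :=
  DiffAt.prodField ((smoothVField_zero I M).diffAt _)
    (smoothVField_eulerField.diffAt _)

lemma DiffAt.prodField_zero (hX : DiffAt X p.1) :
    DiffAt (SasakiLike.prodField X (0 : VField 𝓘(ℝ, ℝ) negReals)) p :=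
  hX.prodField ((smoothVField_zero 𝓘(ℝ, ℝ) negReals).diffAt _)

lemma DiffAt.coneField (hX : DiffAt X p.1) (hu : MDifferentiableAt I 𝓘(ℝ, ℝ) u p.1) :
    DiffAt (coneField X u) p := by
  rw [coneField_eq]
  exact hX.prodField_zero.add (diffAt_prodField_zero_left.smul (mdifferentiableAt_comp_fst hu))

omit [IsManifold I 1 M] in
lemma deriveAlong_coneField (hu : MDifferentiableAt I 𝓘(ℝ, ℝ) u p.1)
    (hv : MDifferentiableAt I 𝓘(ℝ, ℝ) v p.1) (w : M → ℝ) :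
    deriveAlong (coneField X w) (fun q : Cone M ↦ (q.2 : ℝ) ^ 2 * u q.1 + v q.1) p
      = (p.2 : ℝ) ^ 2 * deriveAlong X u p.1 + deriveAlong X v p.1
        + 2 * (p.2 : ℝ) ^ 2 * w p.1 * u p.1 := by
  have hr : MDifferentiableAt (I.prod 𝓘(ℝ, ℝ)) 𝓘(ℝ, ℝ) (fun p : Cone M ↦ (p.2 : ℝ)) p :=
    hasMFDerivAt_radius.mdifferentiableAt
  have hu' := mdifferentiableAt_comp_fst hu
  have hv' := mdifferentiableAt_comp_fst hv
  have e : (fun q : Cone M ↦ (q.2 : ℝ) ^ 2 * u q.1 + v q.1)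
      = (fun q : Cone M ↦ (q.2 : ℝ)) * ((fun q : Cone M ↦ (q.2 : ℝ)) * fun q ↦ u q.1)
        + fun q ↦ v q.1 := by
    ext q; simp; ring
  rw [deriveAlong, e, mvfderiv_add (hr.mul (hr.mul hu')) hv', mvfderiv_mul hr (hr.mul hu'),
    mvfderiv_mul hr hu']
  simp only [_root_.add_apply, _root_.smul_apply, mvfderiv_comp_fst hu, mvfderiv_comp_fst hv,
    mvfderiv_radius, deriveAlong, Pi.mul_apply, smul_eq_mul]
  simp only [horiz_coneField, radial_coneField]
  ring

variable [IsManifold I 2 M] [FiniteDimensional ℝ E]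

lemma bracket_coneField (hX : DiffAt X p.1) (hY : DiffAt Y p.1)
    (hu : MDifferentiableAt I 𝓘(ℝ, ℝ) u p.1) (hv : MDifferentiableAt I 𝓘(ℝ, ℝ) v p.1) :
    bracket (coneField X u) (coneField Y v) p
      = coneField (bracket X Y) (fun q ↦ deriveAlong X v q - deriveAlong Y u q) p := by
  have : CompleteSpace E := FiniteDimensional.complete ℝ E
  have h0 : DiffAt (0 : VField I M) p.1 := (smoothVField_zero I M).diffAt _
  have h0' : DiffAt (0 : VField 𝓘(ℝ, ℝ) negReals) p.2 :=
    (smoothVField_zero 𝓘(ℝ, ℝ) negReals).diffAt _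
  have hT : DiffAt eulerField p.2 := smoothVField_eulerField.diffAt _
  have hT' : DiffAt (prodField (0 : VField I M) eulerField) p := diffAt_prodField_zero_left
  have hX' := hX.prodField_zero
  have hY' := hY.prodField_zero
  have hu' := mdifferentiableAt_comp_fst hu
  have hv' := mdifferentiableAt_comp_fst hv
  have b1 := mlieBracket_prodField hX hY h0' h0'
  have b2 := mlieBracket_prodField hX h0 h0' hT
  have b3 := mlieBracket_prodField h0 hY hT h0'
  have b4 := mlieBracket_prodField h0 h0 hT hT
  rw [bracket, coneField_eq X, coneField_eq Y,
    VectorField.mlieBracket_add_left hX' (hT'.smul hu'),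
    VectorField.mlieBracket_add_right hY' (hT'.smul hv'),
    VectorField.mlieBracket_add_right hY' (hT'.smul hv'),
    VectorField.mlieBracket_smul_right hv' hT',
    VectorField.mlieBracket_smul_left hu' hT',
    VectorField.mlieBracket_smul_left hu' hT',
    VectorField.mlieBracket_smul_right hv' hT', b1, b2, b3, b4]
  simp only [VectorField.mlieBracket_self, VectorField.mlieBracket_zero_left,
    VectorField.mlieBracket_zero_right, prodField_zero_zero, mvfderiv_comp_fst hu,
    mvfderiv_comp_fst hv]
  apply cone_tangent_ext
  · simp
  · simp [deriveAlong]
    ring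

end Cone

section ConeConnection

variable {E : Type*} [NormedAddCommGroup E] [NormedSpace ℝ E]
  {H : Type*} [TopologicalSpace H] {I : ModelWithCorners ℝ E H}
  {M : Type*} [TopologicalSpace M] [ChartedSpace H M]

/-- The field of bilinear forms `α ⊗ α`. -/
def tensorSquare (α : OneForm I M) : BilinField I M := fun p ↦ (α p).smulRight (α p)

@[simp] lemma tensorSquare_apply (α : OneForm I M) (p : M) (v w : TangentSpace I p) :
    tensorSquare α p v w = α p v * α p w := by
  simp [tensorSquare]

variable {φ : EndField I M} {ξ : VField I M} {η : OneForm I M} {g : BilinField I M} {p : Cone M}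

@[simp] lemma horiz_coneJ (a : TangentSpace (I.prod 𝓘(ℝ, ℝ)) p) :
    horiz p (coneJ φ ξ η p a) = φ p.1 (horiz p a) - ((p.2 : ℝ)⁻¹ * radial p a) • ξ p.1 := rfl

@[simp] lemma radial_coneJ (a : TangentSpace (I.prod 𝓘(ℝ, ℝ)) p) :
    radial p (coneJ φ ξ η p a) = p.2 * η p.1 (horiz p a) := rfl

lemma coneMetric_apply (a b : TangentSpace (I.prod 𝓘(ℝ, ℝ)) p) :
    coneMetric η g p a b = (p.2 : ℝ) ^ 2 * (g p.1 (horiz p a) (horiz p b)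
        - η p.1 (horiz p a) * η p.1 (horiz p b))
      + η p.1 (horiz p a) * η p.1 (horiz p b)
      - ((p.2 : ℝ) ^ 2)⁻¹ * (radial p a * radial p b) := rfl

omit [TopologicalSpace M] in
lemma radius_ne_zero (p : Cone M) : (p.2 : ℝ) ≠ 0 := ne_of_lt p.2.2

lemma coneJ_coneField (X : VField I M) (u : M → ℝ) :
    (fun q ↦ coneJ φ ξ η q (coneField X u q))
      = coneField (fun q ↦ φ q (X q) - u q • ξ q) (fun q ↦ η q (X q)) := by
  ext1 q
  have hr := radius_ne_zero q
  apply cone_tangent_ext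
  · simp only [horiz_coneJ, horiz_coneField, radial_coneField]
    rw [mul_comm (u q.1), inv_mul_cancel_left₀ hr]
  · simp only [radial_coneJ, horiz_coneField, radial_coneField, mul_comm]

lemma pairing_coneField (X Y : VField I M) (u v : M → ℝ) :
    pairing (coneMetric η g) (coneField X u) (coneField Y v) =
      fun q : Cone M ↦ (q.2 : ℝ) ^ 2 * (pairing g X Y - pairing (tensorSquare η) X Y) q.1
        + (pairing (tensorSquare η) X Y - u * v) q.1 := by
  ext q
  have := radius_ne_zero q
  simp only [pairing, coneMetric_apply, horiz_coneField, radial_coneField, tensorSquare_apply,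
    Pi.sub_apply, Pi.mul_apply]
  field_simp
  ring

variable [IsManifold I 1 M]

lemma mdifferentiableAt_pairing_tensorSquare (hη : SmoothOneForm η) {X Y : VField I M} {p : M}
    (hX : DiffAt X p) (hY : DiffAt Y p) :
    MDifferentiableAt I 𝓘(ℝ, ℝ) (pairing (tensorSquare η) X Y) p := by
  have e : pairing (tensorSquare η) X Y = (fun q ↦ η q (X q)) * fun q ↦ η q (Y q) := by
    ext q; simp [pairing]
  rw [e]
  exact (hη.mdifferentiableAt hX).mul (hη.mdifferentiableAt hY)

lemma exists_coneField (a : TangentSpace (I.prod 𝓘(ℝ, ℝ)) p) :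
    ∃ (X : VField I M) (c : ℝ), DiffAt X p.1 ∧ coneField X (fun _ ↦ c) p = a := by
  refine ⟨FiberBundle.extend E (horiz p a), radial p a / p.2,
    FiberBundle.mdifferentiableAt_extend I E _, cone_tangent_ext ?_ ?_⟩
  · simp
  · simp [radius_ne_zero p]

variable [IsManifold I 2 M] [FiniteDimensional ℝ E]

lemma koszul_coneField {k l : ℕ} (hg : IsPseudoRiemannian k l g) (hη : SmoothOneForm η)
    {X Y Z : VField I M} {u v w : M → ℝ} (hX : DiffAt X p.1) (hY : DiffAt Y p.1)
    (hZ : DiffAt Z p.1) (hu : MDifferentiableAt I 𝓘(ℝ, ℝ) u p.1)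
    (hv : MDifferentiableAt I 𝓘(ℝ, ℝ) v p.1) (hw : MDifferentiableAt I 𝓘(ℝ, ℝ) w p.1) :
    koszul (coneMetric η g) (coneField X u) (coneField Y v) (coneField Z w) p =
      (p.2 : ℝ) ^ 2 * koszul g X Y Z p.1
      + (1 - (p.2 : ℝ) ^ 2) * koszul (tensorSquare η) X Y Z p.1
      + 2 * (p.2 : ℝ) ^ 2 * (u p.1 * (pairing g Y Z - pairing (tensorSquare η) Y Z) p.1
        + v p.1 * (pairing g Z X - pairing (tensorSquare η) Z X) p.1
        - w p.1 * (pairing g X Y - pairing (tensorSquare η) X Y) p.1)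
      - 2 * w p.1 * deriveAlong X v p.1 := by
  have key {X Y Z : VField I M} {u v w : M → ℝ} (hY : DiffAt Y p.1)
      (hZ : DiffAt Z p.1) (hv : MDifferentiableAt I 𝓘(ℝ, ℝ) v p.1)
      (hw : MDifferentiableAt I 𝓘(ℝ, ℝ) w p.1) :
      deriveAlong (coneField X u) (pairing (coneMetric η g) (coneField Y v) (coneField Z w)) p =
        (p.2 : ℝ) ^ 2 * (deriveAlong X (pairing g Y Z) p.1
          - deriveAlong X (pairing (tensorSquare η) Y Z) p.1)
        + deriveAlong X (pairing (tensorSquare η) Y Z) p.1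
        - (v p.1 * deriveAlong X w p.1 + w p.1 * deriveAlong X v p.1)
        + 2 * (p.2 : ℝ) ^ 2 * u p.1 * (pairing g Y Z - pairing (tensorSquare η) Y Z) p.1 := by
    have h1 := mdifferentiableAt_pairing hg.smooth hY hZ
    have h2 := mdifferentiableAt_pairing_tensorSquare hη hY hZ
    rw [pairing_coneField, deriveAlong_coneField (h1.sub h2) (h2.sub (hv.mul hw))]
    simp only [deriveAlong, mvfderiv_sub h1 h2, mvfderiv_sub h2 (hv.mul hw), mvfderiv_mul hv hw,
      _root_.sub_apply, _root_.add_apply, _root_.smul_apply, smul_eq_mul]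
    ring
  have hr := radius_ne_zero p
  rw [koszul, key hY hZ hv hw, key hZ hX hw hu, key hX hY hu hv]
  simp only [pairing]
  rw [bracket_coneField hX hY hu hv, bracket_coneField hY hZ hv hw, bracket_coneField hZ hX hw hu]
  simp only [koszul, pairing, coneMetric_apply, horiz_coneField, radial_coneField,
    tensorSquare_apply, Pi.sub_apply]
  field_simp
  ring

lemma leviCivita_coneField {n k l : ℕ} (hM : IsAlmostContactComplexRiemannian n φ ξ η g)
    (hC : IsPseudoRiemannian k l (coneMetric η g)) {X Y : VField I M} {u v : M → ℝ} {β : ℝ}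
    (hX : DiffAt X p.1) (hY : DiffAt Y p.1) (hu : MDifferentiableAt I 𝓘(ℝ, ℝ) u p.1)
    (hv : MDifferentiableAt I 𝓘(ℝ, ℝ) v p.1)
    (hβ : ∀ Z : VField I M, DiffAt Z p.1 →
      (1 - (p.2 : ℝ) ^ 2) * (koszul (tensorSquare η) X Y Z p.1
        - 2 * (η p.1 (leviCivita g X Y p.1) * η p.1 (Z p.1))) = 2 * β * η p.1 (Z p.1)) :
    leviCivita (coneMetric η g) (coneField X u) (coneField Y v) p =
      coneField (fun q ↦ leviCivita g X Y q + β • ξ q + u q • (Y q - η q (Y q) • ξ q)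
          + v q • (X q - η q (X q) • ξ q))
        (fun _ ↦ (p.2 : ℝ) ^ 2 * (g p.1 (X p.1) (Y p.1) - η p.1 (X p.1) * η p.1 (Y p.1))
          + deriveAlong X v p.1) p := by
  refine hC.eq_of_forall fun W hW ↦ ?_
  obtain ⟨Z, c, hZ, hc⟩ := exists_coneField (W p)
  have hc' : MDifferentiableAt I 𝓘(ℝ, ℝ) (fun _ : M ↦ c) p.1 := mdifferentiableAt_const
  have h1 := two_mul_leviCivita hC (hX.coneField hu) (hY.coneField hv) _ (hZ.coneField hc')
  rw [koszul_coneField hM.metric hM.smooth_η hX hY hZ hu hv hc',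
    ← two_mul_leviCivita hM.metric hX hY Z hZ] at h1
  have h2 := hβ Z hZ
  have hr := radius_ne_zero p
  rw [← hc]
  have hs := hM.metric.symm p.1
  simp only [pairing, tensorSquare_apply, Pi.sub_apply, hs (Z p.1) (X p.1)] at h1
  have h3 : 2 * coneMetric η g p (coneField (fun q ↦ leviCivita g X Y q + β • ξ q
      + u q • (Y q - η q (Y q) • ξ q) + v q • (X q - η q (X q) • ξ q))
        (fun _ ↦ (p.2 : ℝ) ^ 2 * (g p.1 (X p.1) (Y p.1) - η p.1 (X p.1) * η p.1 (Y p.1))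
          + deriveAlong X v p.1) p) (coneField Z (fun _ ↦ c) p)
      = 2 * ((p.2 : ℝ) ^ 2 * (g p.1 (leviCivita g X Y p.1) (Z p.1)
            + u p.1 * (g p.1 (Y p.1) (Z p.1) - η p.1 (Y p.1) * η p.1 (Z p.1))
            + v p.1 * (g p.1 (X p.1) (Z p.1) - η p.1 (X p.1) * η p.1 (Z p.1)))
          + (1 - (p.2 : ℝ) ^ 2) * (η p.1 (leviCivita g X Y p.1) * η p.1 (Z p.1))
          + β * η p.1 (Z p.1)
        - ((p.2 : ℝ) ^ 2 * (g p.1 (X p.1) (Y p.1) - η p.1 (X p.1) * η p.1 (Y p.1))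
          + deriveAlong X v p.1) * c) := by
    rw [coneMetric_apply]
    simp only [horiz_coneField, radial_coneField, map_add, map_sub, map_smul, _root_.add_apply,
      _root_.sub_apply, _root_.smul_apply, smul_eq_mul, hM.metric_ξ_left, hM.η_ξ]
    field_simp
    ring
  linear_combination (h1 - h3 + h2) / 2

lemma koszul_tensorSquare {n : ℕ} (hM : IsAlmostContactComplexRiemannian n φ ξ η g) {p : M}
    (hξ : ∀ X : VField I M, DiffAt X p → leviCivita g X ξ p = -φ p (X p))
    {X Y Z : VField I M} (hX : DiffAt X p) (hY : DiffAt Y p) (hZ : DiffAt Z p) :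
    koszul (tensorSquare η) X Y Z p
      = 2 * (η p (leviCivita g X Y p) - g p (φ p (X p)) (Y p)) * η p (Z p) := by
  have key {X Y Z : VField I M} (hX : DiffAt X p) (hY : DiffAt Y p) (hZ : DiffAt Z p) :
      deriveAlong X (pairing (tensorSquare η) Y Z) p
        = (η p (leviCivita g X Y p) - g p (φ p (X p)) (Y p)) * η p (Z p)
          + η p (Y p) * (η p (leviCivita g X Z p) - g p (φ p (X p)) (Z p)) := by
    have e : pairing (tensorSquare η) Y Z = (fun q ↦ η q (Y q)) * fun q ↦ η q (Z q) := by
      ext q; simp [pairing]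
    have h1 := hM.deriveAlong_η hX hY
    have h2 := hM.deriveAlong_η hX hZ
    rw [hξ X hX] at h1 h2
    rw [deriveAlong] at h1 h2
    rw [e, deriveAlong, mvfderiv_mul (hM.smooth_η.mdifferentiableAt hY)
      (hM.smooth_η.mdifferentiableAt hZ)]
    simp only [_root_.add_apply, _root_.smul_apply, h1, h2, map_neg, _root_.neg_apply, smul_eq_mul]
    ring
  have hs (v w : TangentSpace I p) : g p (φ p v) w = g p (φ p w) v := by
    rw [hM.metric_φ_left, hM.metric.symm]
  rw [koszul, key hX hY hZ, key hY hZ hX, key hZ hX hY]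
  simp only [pairing, tensorSquare_apply]
  rw [← leviCivita_sub_swap hM.metric hX hY, ← leviCivita_sub_swap hM.metric hY hZ,
    ← leviCivita_sub_swap hM.metric hZ hX, hs (Y p) (X p), hs (Z p) (X p), hs (Z p) (Y p)]
  simp only [map_sub]
  ring

/-- The cone of an almost contact complex Riemannian manifold whose structure has the Sasaki-like
derivative at `p.1` has parallel complex structure at `p`, on the fields `X + u r d/dr`. -/
lemma covDerivEnd_coneJ_eq_zero {n k l : ℕ} (hM : IsAlmostContactComplexRiemannian n φ ξ η g)
    (hC : IsPseudoRiemannian k l (coneMetric η g))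
    (h : ∀ X Y : VField I M, DiffAt X p.1 → DiffAt Y p.1 → covDerivEnd g φ X Y p.1 =
      -(g p.1 (X p.1) (Y p.1) • ξ p.1) - η p.1 (Y p.1) • X p.1
        + (2 * η p.1 (X p.1) * η p.1 (Y p.1)) • ξ p.1)
    {X Y : VField I M} (hX : DiffAt X p.1) (hY : DiffAt Y p.1) (a b : ℝ) :
    covDerivEnd (coneMetric η g) (coneJ φ ξ η) (coneField X fun _ ↦ a) (coneField Y fun _ ↦ b) p
      = 0 := by
  have hξ (X : VField I M) (hX : DiffAt X p.1) : leviCivita g X ξ p.1 = -φ p.1 (X p.1) := by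
    rw [hM.leviCivita_ξ hX, h X ξ hX hM.diffAt_ξ]
    simp only [map_add, map_sub, map_neg, map_smul, hM.φ_ξ, hM.η_ξ]
    module
  have ha : MDifferentiableAt I 𝓘(ℝ, ℝ) (fun _ : M ↦ a) p.1 := mdifferentiableAt_const
  have hb : MDifferentiableAt I 𝓘(ℝ, ℝ) (fun _ : M ↦ b) p.1 := mdifferentiableAt_const
  have hb' : MDifferentiableAt I 𝓘(ℝ, ℝ) (fun _ : M ↦ -b) p.1 := mdifferentiableAt_const
  have hφY := hM.diffAt_φ hY
  have eY : (fun q ↦ φ q (Y q) - b • ξ q) = (fun q ↦ φ q (Y q)) + (fun _ : M ↦ -b) • ξ := by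
    ext1 q; simp [sub_eq_add_neg]
  have hY' : DiffAt (fun q ↦ φ q (Y q) - b • ξ q) p.1 := by
    rw [eY]; exact hφY.add (hM.diffAt_ξ.smul hb')
  have lY : leviCivita g X (fun q ↦ φ q (Y q) - b • ξ q) p.1
      = φ p.1 (leviCivita g X Y p.1) - g p.1 (X p.1) (Y p.1) • ξ p.1 - η p.1 (Y p.1) • X p.1
        + (2 * η p.1 (X p.1) * η p.1 (Y p.1)) • ξ p.1 + b • φ p.1 (X p.1) := by
    have := h X Y hX hY
    rw [covDerivEnd, sub_eq_iff_eq_add] at this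
    rw [eY, leviCivita_add_right hM.metric hX hφY (hM.diffAt_ξ.smul hb'),
      leviCivita_smul_right hM.metric hb' hX hM.diffAt_ξ, hξ X hX, this, deriveAlong_const]
    module
  have hβ {Y : VField I M} (hY : DiffAt Y p.1) (Z : VField I M) (hZ : DiffAt Z p.1) :
      (1 - (p.2 : ℝ) ^ 2) * (koszul (tensorSquare η) X Y Z p.1
        - 2 * (η p.1 (leviCivita g X Y p.1) * η p.1 (Z p.1)))
      = 2 * (-(1 - (p.2 : ℝ) ^ 2) * g p.1 (φ p.1 (X p.1)) (Y p.1)) * η p.1 (Z p.1) := by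
    rw [koszul_tensorSquare hM hξ hX hY hZ]
    ring
  rw [covDerivEnd, coneJ_coneField,
    leviCivita_coneField hM hC hX hY' ha (hM.smooth_η.mdifferentiableAt hY) (hβ hY'),
    leviCivita_coneField hM hC hX hY ha hb (hβ hY)]
  have hr := radius_ne_zero p
  apply cone_tangent_ext
  · simp only [map_sub, map_zero, map_add, map_smul, horiz_coneJ, horiz_coneField,
      radial_coneField, deriveAlong_const, lY, hM.φ_ξ, hM.η_φ, hM.η_ξ, hM.compatible,
      hM.metric_ξ_right, smul_eq_mul]
    rw [mul_comm _ (p.2 : ℝ), inv_mul_cancel_left₀ hr]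
    module
  · simp only [map_sub, map_zero, map_add, map_smul, map_neg, radial_coneJ, horiz_coneField,
      radial_coneField, hM.deriveAlong_η hX hY, hξ X hX, hM.η_φ, hM.η_ξ,
      hM.metric_ξ_right, hM.metric_φ_left, _root_.neg_apply, smul_eq_mul]
    ring

/-- If the complex structure of the cone is parallel, the structure on the slice `r = -1` has the
Sasaki-like derivative. -/
lemma covDerivEnd_eq_of_coneJ {n k l : ℕ} (hM : IsAlmostContactComplexRiemannian n φ ξ η g)
    (hC : IsPseudoRiemannian k l (coneMetric η g)) (hp : (p.2 : ℝ) = -1)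
    {X Y : VField I M} (hX : DiffAt X p.1) (hY : DiffAt Y p.1)
    (h : covDerivEnd (coneMetric η g) (coneJ φ ξ η) (coneField X fun _ ↦ 0) (coneField Y fun _ ↦ 0)
      p = 0) :
    covDerivEnd g φ X Y p.1 = -(g p.1 (X p.1) (Y p.1) • ξ p.1) - η p.1 (Y p.1) • X p.1
        + (2 * η p.1 (X p.1) * η p.1 (Y p.1)) • ξ p.1 := by
  have h0 : MDifferentiableAt I 𝓘(ℝ, ℝ) (fun _ : M ↦ (0 : ℝ)) p.1 := mdifferentiableAt_const
  have hβ (Y Z : VField I M) :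
      (1 - (p.2 : ℝ) ^ 2) * (koszul (tensorSquare η) X Y Z p.1
        - 2 * (η p.1 (leviCivita g X Y p.1) * η p.1 (Z p.1))) = 2 * 0 * η p.1 (Z p.1) := by
    rw [hp]; ring
  have eY : (fun q ↦ φ q (Y q) - (0 : ℝ) • ξ q) = (fun q ↦ φ q (Y q)) := by
    ext1 q; simp
  rw [covDerivEnd, coneJ_coneField, eY, leviCivita_coneField hM hC hX (hM.diffAt_φ hY) h0
      (hM.smooth_η.mdifferentiableAt hY) (fun Z _ ↦ hβ _ Z),
    leviCivita_coneField hM hC hX hY h0 h0 (fun Z _ ↦ hβ _ Z)] at h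
  have h1 := congrArg (horiz p) h
  simp only [map_sub, map_zero, map_add, map_smul, horiz_coneJ, horiz_coneField, radial_coneField,
    deriveAlong_const, hM.φ_ξ, hp] at h1
  rw [covDerivEnd, ← sub_eq_zero]
  refine Eq.trans ?_ h1
  module

end ConeConnection

section HomBundle

variable {E : Type*} [NormedAddCommGroup E] [NormedSpace ℝ E]
  {H : Type*} [TopologicalSpace H] {I : ModelWithCorners ℝ E H}
  {M : Type*} [TopologicalSpace M] [ChartedSpace H M]
  {F₁ : Type*} [NormedAddCommGroup F₁] [NormedSpace ℝ F₁] [FiniteDimensional ℝ F₁]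
  {V₁ : M → Type*} [TopologicalSpace (TotalSpace F₁ V₁)] [∀ x, AddCommGroup (V₁ x)]
  [∀ x, Module ℝ (V₁ x)] [∀ x, TopologicalSpace (V₁ x)] [FiberBundle F₁ V₁] [VectorBundle ℝ F₁ V₁]
  {F₂ : Type*} [NormedAddCommGroup F₂] [NormedSpace ℝ F₂]
  {V₂ : M → Type*} [TopologicalSpace (TotalSpace F₂ V₂)] [∀ x, AddCommGroup (V₂ x)]
  [∀ x, Module ℝ (V₂ x)] [∀ x, TopologicalSpace (V₂ x)] [FiberBundle F₂ V₂] [VectorBundle ℝ F₂ V₂]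
  [∀ x, IsTopologicalAddGroup (V₂ x)] [∀ x, ContinuousSMul ℝ (V₂ x)] {n : WithTop ℕ∞}

/-- A family of linear maps between the fibers of two vector bundles is smooth if it maps smooth
sections to smooth sections. -/
lemma contMDiffAt_hom_of_forall_section [ContMDiffVectorBundle n F₁ V₁ I]
    {A : ∀ p, V₁ p →L[ℝ] V₂ p} {p₀ : M}
    (h : ∀ Y : ∀ p, V₁ p,
      ContMDiffAt I (I.prod 𝓘(ℝ, F₁)) n (fun p ↦ TotalSpace.mk' F₁ p (Y p)) p₀ →
      ContMDiffAt I (I.prod 𝓘(ℝ, F₂)) n (fun p ↦ TotalSpace.mk' F₂ p (A p (Y p))) p₀) :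
    ContMDiffAt I (I.prod 𝓘(ℝ, F₁ →L[ℝ] F₂)) n
      (fun p ↦ TotalSpace.mk' (F₁ →L[ℝ] F₂) (E := fun q ↦ V₁ q →L[ℝ] V₂ q) p (A p)) p₀ := by
  rw [contMDiffAt_hom_bundle]
  refine ⟨contMDiffAt_id, ?_⟩
  set b := Module.finBasis ℝ F₁
  set t₁ := trivializationAt F₁ V₁ p₀
  set t₂ := trivializationAt F₂ V₂ p₀
  have hm₁ : p₀ ∈ t₁.baseSet := FiberBundle.mem_baseSet_trivializationAt' p₀
  have hm₂ : p₀ ∈ t₂.baseSet := FiberBundle.mem_baseSet_trivializationAt' p₀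
  have hY (i) : ContMDiffAt I 𝓘(ℝ, F₂) n (fun p ↦ (t₂ ⟨p, A p (t₁.symm p (b i))⟩).2) p₀ := by
    have := h _ (FiberBundle.contMDiffAt_extend (k := n) I F₁ (t₁.symm p₀ (b i)))
    rw [contMDiffAt_section] at this
    refine this.congr_of_eventuallyEq (Filter.Eventually.of_forall fun p ↦ ?_)
    simp [FiberBundle.extend, t₁, t₂, hm₁]
  have hS : ContMDiffAt I 𝓘(ℝ, F₁ →L[ℝ] F₂) n (fun p ↦ ∑ i,
      ContinuousLinearMap.smulRightL ℝ F₁ F₂ (LinearMap.toContinuousLinearMap (b.coord i))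
        (t₂ ⟨p, A p (t₁.symm p (b i))⟩).2) p₀ := by
    refine ContMDiffAt.sum fun i _ ↦ ?_
    exact (ContinuousLinearMap.contMDiff _).contMDiffAt.comp p₀ (hY i)
  refine hS.congr_of_eventuallyEq ?_
  filter_upwards [t₁.open_baseSet.mem_nhds hm₁, t₂.open_baseSet.mem_nhds hm₂] with p hp₁ hp₂
  refine ContinuousLinearMap.coe_injective (b.ext fun j ↦ ?_)
  simp [ContinuousLinearMap.inCoordinates_eq hp₁ hp₂, Finsupp.single_apply]
  rfl

end HomBundle

section Signature

variable {V : Type*} [AddCommGroup V] [Module ℝ V] [FiniteDimensional ℝ V]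

/-- A nondegenerate quadratic form with a complex structure which is an anti-isometry has neutral
signature. -/
lemma sigPos_eq_and_sigNeg_eq_of_antiIsometry {Q : QuadraticForm ℝ V} {J : V →ₗ[ℝ] V} {m : ℕ}
    (hJ : ∀ v, J (J v) = -v) (hQ : ∀ v, Q (J v) = -Q v) (hrad : Q.radical = ⊥)
    (hV : Module.finrank ℝ V = 2 * m) : sigPos Q = m ∧ sigNeg Q = m := by
  let e : V ≃ₗ[ℝ] V := LinearEquiv.ofLinearMap J (-J) (by ext v; simp [hJ]) (by ext v; simp [hJ])
  have he : QuadraticMap.Equivalent Q (-Q) := ⟨⟨e, fun v ↦ by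
    change (-Q) (J v) = Q v
    simp [hQ]⟩⟩
  have h1 := he.sigPos_eq
  have h2 := QuadraticForm.sigPos_add_sigNeg_add_radical (Q := Q)
  rw [_root_.sigPos_neg] at h1
  rw [hrad, finrank_bot, hV] at h2
  omega

end Signature

section ConeStructure

variable {E : Type*} [NormedAddCommGroup E] [NormedSpace ℝ E]
  {H : Type*} [TopologicalSpace H] {I : ModelWithCorners ℝ E H}
  {M : Type*} [TopologicalSpace M] [ChartedSpace H M] [IsManifold I ∞ M]

omit [IsManifold I ∞ M] in
lemma contMDiffAt_trivial_section {f : M → ℝ} {p : M} :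
    ContMDiffAt I (I.prod 𝓘(ℝ, ℝ)) ∞ (fun q ↦ TotalSpace.mk' ℝ (E := Trivial M ℝ) q (f q)) p ↔
      ContMDiffAt I 𝓘(ℝ, ℝ) ∞ f p := by
  rw [contMDiffAt_section]
  rfl

variable {p₀ : Cone M} {Y : VField (I.prod 𝓘(ℝ, ℝ)) (Cone M)}

/-- Smoothness at a point of a vector field. -/
abbrev SmoothAt (X : VField I M) (p : M) : Prop :=
  ContMDiffAt I I.tangent ∞ (fun q ↦ (⟨q, X q⟩ : TangentBundle I M)) p

lemma SmoothAt.horiz (hY : SmoothAt Y p₀) :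
    ContMDiffAt (I.prod 𝓘(ℝ, ℝ)) I.tangent ∞
      (fun p ↦ (⟨p.1, horiz p (Y p)⟩ : TangentBundle I M)) p₀ := by
  have h := (contMDiff_equivTangentBundleProd (n := ∞) (I := I) (M := M) (I' := 𝓘(ℝ, ℝ))
    (M' := negReals)).contMDiffAt.comp p₀ hY
  exact contMDiffAt_fst.comp p₀ h

omit [IsManifold I ∞ M] in
lemma contMDiff_radius : ContMDiff (I.prod 𝓘(ℝ, ℝ)) 𝓘(ℝ, ℝ) ∞ (fun p : Cone M ↦ (p.2 : ℝ)) :=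
  contMDiff_subtype_val.comp contMDiff_snd

omit [IsManifold I ∞ M] in
lemma contMDiff_inv_radius :
    ContMDiff (I.prod 𝓘(ℝ, ℝ)) 𝓘(ℝ, ℝ) ∞ (fun p : Cone M ↦ (p.2 : ℝ)⁻¹) :=
  contMDiff_radius.inv₀ radius_ne_zero

lemma SmoothAt.radial (hY : SmoothAt Y p₀) :
    ContMDiffAt (I.prod 𝓘(ℝ, ℝ)) 𝓘(ℝ, ℝ) ∞ (fun p ↦ radial p (Y p)) p₀ := by
  have h := (contMDiff_radius (I := I) (M := M)).contMDiff_tangentMap (m := ∞) (by simp)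
  have h' := ((contMDiff_snd_tangentBundle_modelSpace ℝ 𝓘(ℝ, ℝ)).comp h).contMDiffAt.comp p₀ hY
  refine h'.congr_of_eventuallyEq (Filter.Eventually.of_forall fun p ↦ ?_)
  exact (mvfderiv_radius (Y p)).symm

variable {n : ℕ} {φ : EndField I M} {ξ : VField I M} {η : OneForm I M} {g : BilinField I M}

lemma SmoothOneForm.contMDiffAt_horiz (hη : SmoothOneForm η) (hY : SmoothAt Y p₀) :
    ContMDiffAt (I.prod 𝓘(ℝ, ℝ)) 𝓘(ℝ, ℝ) ∞ (fun p ↦ η p.1 (SasakiLike.horiz p (Y p))) p₀ := by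
  have h := ContMDiffAt.clm_bundle_apply (F₂ := ℝ) (E₂ := Trivial M ℝ) (b := Prod.fst)
    (ContMDiff.comp hη contMDiff_fst).contMDiffAt hY.horiz
  rw [contMDiffAt_totalSpace] at h
  exact h.2

lemma smoothEndField_coneJ [FiniteDimensional ℝ E]
    (hM : IsAlmostContactComplexRiemannian n φ ξ η g) :
    SmoothEndField (coneJ φ ξ η) := by
  intro p₀
  refine contMDiffAt_hom_of_forall_section fun Y hY ↦ ?_
  replace hY : SmoothAt Y p₀ := hY
  have hφ : ContMDiffAt (I.prod 𝓘(ℝ, ℝ)) I.tangent ∞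
      (fun p ↦ (⟨p.1, φ p.1 (horiz p (Y p))⟩ : TangentBundle I M)) p₀ :=
    ContMDiffAt.clm_bundle_apply (b := Prod.fst)
      (ContMDiff.comp hM.smooth_φ contMDiff_fst).contMDiffAt hY.horiz
  obtain ⟨W, h1, e1, e2⟩ : ∃ W : VField (I.prod 𝓘(ℝ, ℝ)) (Cone M), SmoothAt W p₀ ∧
      (∀ p, horiz p (W p) = φ p.1 (horiz p (Y p))) ∧ ∀ p, radial p (W p) = 0 :=
    ⟨fun p ↦ (φ p.1 (horiz p (Y p)), 0),
      (contMDiff_equivTangentBundleProd_symm (n := ∞) (I := I) (M := M) (I' := 𝓘(ℝ, ℝ))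
        (M' := negReals)).contMDiffAt.comp p₀
        (hφ.prodMk ((smoothVField_zero 𝓘(ℝ, ℝ) negReals).comp contMDiff_snd).contMDiffAt),
      fun _ ↦ rfl, fun _ ↦ rfl⟩
  have h2 : SmoothAt (prodField ξ 0) p₀ :=
    (hM.smooth_ξ.prodField (smoothVField_zero 𝓘(ℝ, ℝ) negReals)).contMDiffAt
  have h3 : SmoothAt (prodField (0 : VField I M) eulerField) p₀ :=
    ((smoothVField_zero I M).prodField smoothVField_eulerField).contMDiffAt
  have h4 := (contMDiff_inv_radius (I := I) (M := M)).contMDiffAt.mul hY.radial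
  have h5 := hM.smooth_η.contMDiffAt_horiz hY
  refine ((h1.sub_section (h4.smul_section h2)).add_section
    (h5.smul_section h3)).congr_of_eventuallyEq (Filter.Eventually.of_forall fun p ↦ ?_)
  refine congrArg (TotalSpace.mk' (E × ℝ) p) (cone_tangent_ext ?_ ?_)
  · simp [e1]
  · simp [e2, mul_comm]

lemma smoothBilinField_coneMetric [FiniteDimensional ℝ E]
    (hM : IsAlmostContactComplexRiemannian n φ ξ η g) :
    SmoothBilinField (coneMetric η g) := by
  intro p₀
  refine contMDiffAt_hom_of_forall_section fun Y hY ↦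
    contMDiffAt_hom_of_forall_section fun Z hZ ↦ ?_
  replace hY : SmoothAt Y p₀ := hY
  replace hZ : SmoothAt Z p₀ := hZ
  refine contMDiffAt_trivial_section.2 ?_
  have hg : ContMDiffAt (I.prod 𝓘(ℝ, ℝ)) 𝓘(ℝ, ℝ) ∞
      (fun p ↦ g p.1 (horiz p (Y p)) (horiz p (Z p))) p₀ := by
    have h := ContMDiffAt.clm_bundle_apply₂ (F₃ := ℝ) (E₃ := Trivial M ℝ) (b := Prod.fst)
      (ContMDiff.comp hM.metric.smooth contMDiff_fst).contMDiffAt hY.horiz hZ.horiz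
    rw [contMDiffAt_totalSpace] at h
    exact h.2
  have hr := (contMDiff_radius (I := I) (M := M)).contMDiffAt (x := p₀)
  have hr' := (contMDiff_inv_radius (I := I) (M := M)).contMDiffAt (x := p₀)
  have hη := (hM.smooth_η.contMDiffAt_horiz hY).mul (hM.smooth_η.contMDiffAt_horiz hZ)
  refine ((((hr.mul hr).mul (hg.sub hη)).add hη).sub
    ((hr'.mul hr').mul (hY.radial.mul hZ.radial))).congr_of_eventuallyEq
    (Filter.Eventually.of_forall fun p ↦ ?_)
  simp only [coneMetric_apply, Pi.mul_apply, Pi.add_apply]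
  ring

lemma coneJ_coneJ (hM : IsAlmostContactComplexRiemannian n φ ξ η g) (p : Cone M)
    (a : TangentSpace (I.prod 𝓘(ℝ, ℝ)) p) : coneJ φ ξ η p (coneJ φ ξ η p a) = -a := by
  have hr := radius_ne_zero p
  apply cone_tangent_ext
  · simp [hM.φ_φ, hM.φ_ξ, hr]
  · simp [hM.η_φ, hM.η_ξ, hr]

lemma coneMetric_coneJ (hM : IsAlmostContactComplexRiemannian n φ ξ η g) (p : Cone M)
    (a b : TangentSpace (I.prod 𝓘(ℝ, ℝ)) p) :
    coneMetric η g p (coneJ φ ξ η p a) (coneJ φ ξ η p b) = -coneMetric η g p a b := by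
  have hr := radius_ne_zero p
  simp only [coneMetric_apply, horiz_coneJ, radial_coneJ, map_sub, map_smul, _root_.sub_apply,
    _root_.smul_apply, hM.compatible, hM.metric_ξ_left, hM.metric_ξ_right, hM.η_φ, hM.η_ξ,
    smul_eq_mul]
  field_simp
  ring

lemma coneMetric_symm (hM : IsAlmostContactComplexRiemannian n φ ξ η g) (p : Cone M)
    (a b : TangentSpace (I.prod 𝓘(ℝ, ℝ)) p) : coneMetric η g p a b = coneMetric η g p b a := by
  simp only [coneMetric_apply, hM.metric.symm p.1 (horiz p a)]
  ring

lemma coneMetric_nondegenerate (hM : IsAlmostContactComplexRiemannian n φ ξ η g) (p : Cone M)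
    (a : TangentSpace (I.prod 𝓘(ℝ, ℝ)) p) (h : ∀ b, coneMetric η g p a b = 0) : a = 0 := by
  have hr := radius_ne_zero p
  have h1 (v : TangentSpace I p.1) : coneMetric η g p a
      (coneField (FiberBundle.extend E v) (fun _ ↦ 0) p) = 0 := h _
  have h2 : coneMetric η g p a (coneField (0 : VField I M) (fun _ ↦ 1) p) = 0 := h _
  simp only [coneMetric_apply, horiz_coneField, radial_coneField,
    FiberBundle.extend_apply_self, zero_mul, mul_zero, sub_zero] at h1
  simp only [coneMetric_apply, horiz_coneField, radial_coneField, Pi.zero_apply, map_zero,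
    mul_zero, sub_zero, add_zero, zero_sub, one_mul] at h2
  have h3 : η p.1 (horiz p a) = 0 := by
    have := h1 (ξ p.1)
    rw [hM.metric_ξ_right, hM.η_ξ] at this
    linarith
  refine cone_tangent_ext ?_ (by simpa [hr] using h2)
  rw [map_zero]
  refine hM.metric.nondegenerate p.1 _ fun v ↦ ?_
  simpa [h3, hr] using h1 v

lemma isPseudoRiemannian_coneMetric [FiniteDimensional ℝ E] (hE : Module.finrank ℝ E = 2 * n + 1)
    (hM : IsAlmostContactComplexRiemannian n φ ξ η g) :
    IsPseudoRiemannian (n + 1) (n + 1) (coneMetric η g) := by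
  have hQ (p : Cone M) : sigPos (quadraticFormAt (coneMetric η g) p) = n + 1 ∧
      sigNeg (quadraticFormAt (coneMetric η g) p) = n + 1 := by
    have : FiniteDimensional ℝ (TangentSpace (I.prod 𝓘(ℝ, ℝ)) p) :=
      inferInstanceAs (FiniteDimensional ℝ (E × ℝ))
    have hq (a) : quadraticFormAt (coneMetric η g) p a = coneMetric η g p a a := rfl
    refine sigPos_eq_and_sigNeg_eq_of_antiIsometry (J := (coneJ φ ξ η p).toLinearMap)
      (coneJ_coneJ hM p) (fun a ↦ coneMetric_coneJ hM p a a) ?_ ?_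
    · rw [eq_bot_iff]
      intro a ha
      rw [QuadraticMap.mem_radical_iff'] at ha
      refine coneMetric_nondegenerate hM p a fun b ↦ ?_
      have h1 := ha.1
      have h2 := ha.2 b
      simp only [hq, map_add, _root_.add_apply, coneMetric_symm hM p b a] at h1 h2
      linarith
    · change Module.finrank ℝ (E × ℝ) = _
      rw [Module.finrank_prod, hE, Module.finrank_self]
      ring
  exact
  { smooth := smoothBilinField_coneMetric hM
    symm := coneMetric_symm hM
    nondegenerate := coneMetric_nondegenerate hM
    sigPos_eq := fun p ↦ (hQ p).1
    sigNeg_eq := fun p ↦ (hQ p).2 }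

end ConeStructure

section ConeEquivalence

variable {E : Type*} [NormedAddCommGroup E] [NormedSpace ℝ E] [FiniteDimensional ℝ E]
  {H : Type*} [TopologicalSpace H] {I : ModelWithCorners ℝ E H}
  {M : Type*} [TopologicalSpace M] [ChartedSpace H M] [IsManifold I ∞ M] [T2Space M]
  {n : ℕ} {φ : EndField I M} {ξ : VField I M} {η : OneForm I M} {g : BilinField I M}

lemma isHolomorphicComplexRiemannian_cone_iff (hE : Module.finrank ℝ E = 2 * n + 1)
    (hM : IsAlmostContactComplexRiemannian n φ ξ η g) :
    IsHolomorphicComplexRiemannian (n + 1) (coneJ φ ξ η) (coneMetric η g) ↔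
      HasSasakiLikeDerivative φ ξ η g := by
  have hC := isPseudoRiemannian_coneMetric hE hM
  have hJ := smoothEndField_coneJ hM
  constructor
  · intro h X Y hX hY x
    have h0 : ContMDiff I 𝓘(ℝ, ℝ) ∞ (fun _ : M ↦ (0 : ℝ)) := contMDiff_const
    let r : negReals := ⟨-1, by simp [negReals]⟩
    exact covDerivEnd_eq_of_coneJ (p := (x, r)) hM hC rfl (hX.diffAt x) (hY.diffAt x)
      (h.parallel _ _ (hX.coneField h0) (hY.coneField h0) _)
  · intro h
    refine ⟨hJ, coneJ_coneJ hM, hC, coneMetric_coneJ hM, fun X Y hX hY p ↦ ?_⟩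
    rw [hM.hasSasakiLikeDerivative_iff] at h
    obtain ⟨X', a, hX', ha⟩ := exists_coneField (X p)
    obtain ⟨Y', b, hY', hb⟩ := exists_coneField (Y p)
    have ha' : MDifferentiableAt I 𝓘(ℝ, ℝ) (fun _ : M ↦ a) p.1 := mdifferentiableAt_const
    have hb' : MDifferentiableAt I 𝓘(ℝ, ℝ) (fun _ : M ↦ b) p.1 := mdifferentiableAt_const
    rw [← covDerivEndAt_apply hC hJ (hX.diffAt p) (hY.diffAt p), ← ha, ← hb,
      covDerivEndAt_apply hC hJ (hX'.coneField ha') (hY'.coneField hb')]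
    refine covDerivEnd_coneJ_eq_zero hM hC (fun U V hU hV ↦ ?_) hX' hY' a b
    rw [← covDerivEndAt_apply hM.metric hM.smooth_φ hU hV, h]

end ConeEquivalence

end SasakiLike

end

theorem theorem3p3 (n : ℕ)
    {E : Type*} [NormedAddCommGroup E] [NormedSpace ℝ E] [FiniteDimensional ℝ E]
    (hE : Module.finrank ℝ E = 2 * n + 1)
    {M : Type*} [TopologicalSpace M] [T2Space M] [ChartedSpace E M] [IsManifold 𝓘(ℝ, E) ∞ M]
    (φ : SasakiLike.EndField 𝓘(ℝ, E) M) (ξ : SasakiLike.VField 𝓘(ℝ, E) M)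
    (η : SasakiLike.OneForm 𝓘(ℝ, E) M) (g : SasakiLike.BilinField 𝓘(ℝ, E) M)
    (hM : SasakiLike.IsAlmostContactComplexRiemannian n φ ξ η g) :
    List.TFAE [
      -- the complex cone is a holomorphic complex Riemannian manifold
      SasakiLike.IsHolomorphicComplexRiemannian (n + 1)
        (SasakiLike.coneJ φ ξ η) (SasakiLike.coneMetric η g),
      -- the same condition, expressed by the structure tensor of `M`
      SasakiLike.SasakiLikeTensorConditions φ ξ η g,
      -- the formula for the covariant derivative of `φ`
      ∀ X Y : SasakiLike.VField 𝓘(ℝ, E) M,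
        SasakiLike.SmoothVField X → SasakiLike.SmoothVField Y → ∀ p,
          SasakiLike.covDerivEnd g φ X Y p =
            -(g p (X p) (Y p) • ξ p) - η p (Y p) • X p + (2 * η p (X p) * η p (Y p)) • ξ p,
      -- the formulas for the Nijenhuis tensors
      ∀ X Y : SasakiLike.VField 𝓘(ℝ, E) M,
        SasakiLike.SmoothVField X → SasakiLike.SmoothVField Y → ∀ p,
          SasakiLike.nijenhuis φ ξ η X Y p = 0 ∧
          SasakiLike.assocNijenhuis φ ξ g X Y p =
            -((4 * (SasakiLike.associatedMetric φ η g p (X p) (Y p)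
              - η p (X p) * η p (Y p))) • ξ p)] := by
  tfae_have 1 ↔ 3 := SasakiLike.isHolomorphicComplexRiemannian_cone_iff hE hM
  tfae_have 3 ↔ 2 := hM.hasSasakiLikeDerivative_iff_tensorConditions
  tfae_have 3 ↔ 4 := hM.hasSasakiLikeDerivative_iff_nijenhuis
  tfae_finish
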